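/- Let $n\ge 2$ and $d>1$ be integers. Let $X=(X_1,\dots,X_n)$ have the Dirichlet distribution $\mathcal D(d,\dots,d)$ on the simplex $\{x\in\mathbb R^n: x_i>0,\ \sum_i x_i=1\}$, and let $\Theta_1,\dots,\Theta_n$ be i.i.d., uniformly distributed on the unit sphere of the Euclidean space $\mathbb R^d$ and independent of $X$. Put $W=X_1\Theta_1+\cdots+X_n\Theta_n$ and $V=\|W\|^2$, and write $(a)_k=a(a+1)\cdots(a+k-1)$, $(a)_0=1$. Then $V$ has a density $f$ with respect to Lebesgue measure, which vanishes outside $(0,1)$. For every complex $s$ with $\operatorname{Re}s>-d/2$ the integral $M(s)=\int_0^1 f(v)\,v^s\,dv$ converges absolutely and $$M(s)=C\,\frac{\Gamma\left(\frac{nd+n}{2}+s\right)\Gamma\left(\frac d2+s\right)}{\Gamma\left(\frac{nd+1}{2}+s\right)\Gamma\left(\frac{nd}{2}+s\right)},$$ where the constant $C$ is determined by $M(0)=1$. Furthermore: 1. If $n=2N+1$ is odd, there are real numbers $A_0,\dots,A_{Nd-1}$, the sign of $A_k$ being $(-1)^k$, such that for all these $s$ $$M(s)=C\,\frac{\left(s+Nd+\frac{d+1}{2}\right)_N}{\left(\frac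 d2+s\right)_{Nd}}=\sum_{k=0}^{Nd-1}\frac{A_k}{\frac d2+k+s},$$ and $f(v)=\sum_{k=0}^{Nd-1}A_k v^{\frac d2+k-1}$ for almost every $v\in(0,1)$. 2. If $n=2N$ is even, then for all these $s$ $$M(s)=C\,\frac{\Gamma\left(\frac d2+s\right)}{\Gamma\left(Nd+\frac12+s\right)}\,(s+Nd)_N,$$ and $f$ is a mixture of beta densities, $$f(v)\,dv=\sum_{k=0}^N r_k\,\beta\left(\tfrac d2+k,\ Nd-\tfrac{d-1}{2}-k\right)(dv),$$ where all beta parameters are positive and the weights $$r_k=\frac{1}{(Nd)_N}\left(\frac d2\right)_k\left(d\left(N-\tfrac12\right)\right)_{N-k}\binom Nk,\qquad k=0,\dots,N,$$ are positive and satisfy $\sum_{k=0}^N r_k=1$. -/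

import Mathlib

open MeasureTheory ProbabilityTheory

noncomputable section

/-- Density of the Dirichlet distribution with parameters `q₀, …, q_m`, in the first `m` coordinates
`x`, the last coordinate being `1 - ∑ x`. -/
def dirichletPDFReal {m : ℕ} (q : Fin (m + 1) → ℝ) (x : Fin m → ℝ) : ℝ :=
  open Classical in
  if (∀ i, 0 < x i) ∧ ∑ i, x i < 1 then
    Real.Gamma (∑ i, q i) / (∏ i, Real.Gamma (q i)) *
      ((∏ i : Fin m, x i ^ (q i.castSucc - 1)) * (1 - ∑ i, x i) ^ (q (Fin.last m) - 1))
  else 0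

/-- Append to `x₁, …, x_m` the coordinate that makes the sum equal to one. -/
def simplexPoint {m : ℕ} (x : Fin m → ℝ) : Fin (m + 1) → ℝ :=
  Fin.snoc (α := fun _ => ℝ) x (1 - ∑ i, x i)

/-- The Dirichlet distribution `𝒟(q₁, …, q_n)` on `ℝⁿ` (carried by the unit simplex), for `n ≥ 1` and
positive `q_i`. There is none for `n = 0`, where the value is the zero measure. -/
def dirichletMeasure : (n : ℕ) → (Fin n → ℝ) → Measure (Fin n → ℝ)
  | 0, _ => 0
  | m + 1, q =>
    (volume.withDensity (fun x : Fin m → ℝ => ENNReal.ofReal (dirichletPDFReal q x))).map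
      simplexPoint

theorem measurable_simplexPoint {m : ℕ} : Measurable (simplexPoint (m := m)) := by
  refine measurable_pi_lambda _ fun i => ?_
  refine Fin.lastCases ?_ (fun j => ?_) i
  · simp only [simplexPoint, Fin.snoc_last]
    fun_prop
  · simp only [simplexPoint, Fin.snoc_castSucc]
    fun_prop

/-- The uniform distribution on the unit sphere of the Euclidean space `ℝᵈ` (for `d ≥ 1`), as a
measure on `ℝᵈ`: the normalized surface measure. -/
def uniformSphere (d : ℕ) : Measure (EuclideanSpace ℝ (Fin d)) :=
  ((volume : Measure (EuclideanSpace ℝ (Fin d))).toSphere Set.univ)⁻¹ •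
    (volume : Measure (EuclideanSpace ℝ (Fin d))).toSphere.map Subtype.val

/-- `X₁, …, X_n` and `Θ₁, …, Θ_n` drive a Dirichlet random walk governed by `𝒟(q₁, …, q_n)` in `ℝᵈ`:
`X` has law `𝒟(q₁, …, q_n)`, the `Θ_i` are i.i.d. uniform on the unit sphere and independent
of `X`. -/
structure IsDirichletWalk {Ω : Type*} [MeasurableSpace Ω] (P : Measure Ω) {n d : ℕ}
    (q : Fin n → ℝ) (X : Ω → Fin n → ℝ) (Θ : Fin n → Ω → EuclideanSpace ℝ (Fin d)) : Prop where
  law_weights : HasLaw X (dirichletMeasure n q) P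
  law_directions : ∀ i, HasLaw (Θ i) (uniformSphere d) P
  indep_directions : iIndepFun Θ P
  indep_weights : IndepFun X (fun ω i => Θ i ω) P

/-- The end point `W = X₁ Θ₁ + ⋯ + X_n Θ_n`. -/
def walkEnd {Ω : Type*} {n d : ℕ} (X : Ω → Fin n → ℝ)
    (Θ : Fin n → Ω → EuclideanSpace ℝ (Fin d)) (ω : Ω) : EuclideanSpace ℝ (Fin d) :=
  ∑ i, X ω i • Θ i ω

/-- The Mellin transform `s ↦ ∫₀¹ f(v) vˢ dv` of a function on `(0, 1)`. -/
def mellin01 (f : ℝ → ℝ) (s : ℂ) : ℂ :=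
  ∫ v in Set.Ioo (0 : ℝ) 1, (f v : ℂ) * (v : ℂ) ^ s

/-- The Pochhammer symbol `(a)_k = a (a + 1) ⋯ (a + k - 1)`. -/
def poch {R : Type*} [CommRing R] (a : R) (k : ℕ) : R :=
  ∏ i ∈ Finset.range k, (a + i)

/-- The weights `r_k = (d/2)_k (d(N - 1/2))_{N-k} binom(N, k) / (Nd)_N`. -/
def mixWeight (d N k : ℕ) : ℝ :=
  1 / poch ((N : ℝ) * d) N * poch ((d : ℝ) / 2) k * poch ((d : ℝ) * (N - 1 / 2)) (N - k) *
    (N.choose k : ℝ)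

end

/-! For a unit vector `u`, expand `⟨u, W⟩ ^ M` by the multinomial theorem. Independence splits each
term into a mixed Dirichlet moment, `∏ (d)_{k_i} / (nd)_M`, and moments of coordinates on the
sphere. Because the Dirichlet parameter equals the dimension, `(d)_k` times the `k`-th sphere moment
is `k!` times the coefficient of `x ^ k` in `(1 - x²) ^ (-(d + 1) / 2)`. The multinomial sum is
therefore a coefficient of the `n`-th power of this series, again a power of `1 - x²`; this gives
`IsDirichletWalk.integral_inner_pow`. Averaging over a further uniform direction converts these into
the moments of `V = ‖W‖²` (`IsDirichletWalk.integral_norm_sq_pow`), which are the values of the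
Gamma quotient `walkMellin` at the natural numbers.

The density is then exhibited rather than obtained by inversion. For odd `n` the quotient is
rational and partial fractions write it as the Mellin transform of a combination of powers of `v`;
for even `n` the Chu–Vandermonde identity writes it as that of a mixture of beta densities. A finite
measure on `[0, 1]` is determined by its moments, so the explicit function is a density of `V`
(`eq_withDensity_of_moments`), and its Mellin transform on the whole half-plane is already known. -/

/-! ### Rising factorials and the Gamma function. -/

section Pochhammer

variable {R : Type*} [CommRing R]

@[simp] theorem poch_zero (a : R) : poch a 0 = 1 := by simp [poch]

theorem poch_succ (a : R) (k : ℕ) : poch a (k + 1) = poch a k * (a + k) := by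
  simp [poch, Finset.prod_range_succ]

theorem poch_pos {a : ℝ} (ha : 0 < a) (k : ℕ) : 0 < poch a k :=
  Finset.prod_pos fun i _ => by positivity

theorem ofReal_poch (a : ℝ) (k : ℕ) : ((poch a k : ℝ) : ℂ) = poch (a : ℂ) k := by
  simp [poch]

theorem poch_one (k : ℕ) : poch (1 : ℝ) k = (k.factorial : ℝ) := by
  induction k with
  | zero => simp
  | succ k ih => rw [poch_succ, ih, Nat.factorial_succ]; push_cast; ring

/-- Legendre duplication for Pochhammer symbols. -/
theorem poch_two_mul (a : ℝ) (k : ℕ) :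
    poch a (2 * k) = 4 ^ k * poch (a / 2) k * poch ((a + 1) / 2) k := by
  induction k with
  | zero => simp
  | succ k ih =>
    rw [show 2 * (k + 1) = 2 * k + 1 + 1 by ring, poch_succ, poch_succ, ih, poch_succ, poch_succ,
      pow_succ]
    push_cast; ring

/-- The Chu–Vandermonde identity for rising factorials. -/
theorem poch_add_eq_sum (a b : R) (n : ℕ) :
    poch (a + b) n =
      ∑ ij ∈ Finset.HasAntidiagonal.antidiagonal n, (n.choose ij.1 : R) * (poch a ij.1 * poch b ij.2) := by
  induction n with
  | zero => simp
  | succ n ih =>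
    -- Pascal's rule splits the sum for `n + 1` into two; termwise, `a + b + n = (a + i) + (b + j)`
    -- when `i + j = n`.
    rw [poch_succ, ih,
      Finset.sum_antidiagonal_choose_succ_mul (fun i j => poch a i * poch b j) n,
      ← Finset.sum_add_distrib, Finset.sum_mul]
    refine Finset.sum_congr rfl fun ij hij => ?_
    have h : ij.1 + ij.2 = n := by simpa using hij
    rw [Nat.choose_symm_of_eq_add h.symm, poch_succ, poch_succ, ← h]
    push_cast; ring

theorem Real.Gamma_add_natCast {a : ℝ} (ha : 0 < a) (k : ℕ) :
    Real.Gamma (a + k) = poch a k * Real.Gamma a := by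
  induction k with
  | zero => simp
  | succ k ih =>
    rw [poch_succ, Nat.cast_succ, ← add_assoc, Real.Gamma_add_one (by positivity), ih]; ring

theorem Complex.Gamma_add_natCast {a : ℂ} (ha : 0 < a.re) (k : ℕ) :
    Complex.Gamma (a + k) = poch a k * Complex.Gamma a := by
  induction k with
  | zero => simp
  | succ k ih =>
    have h : a + k ≠ 0 := fun h => by
      have := congrArg Complex.re h
      simp at this
      have : (0 : ℝ) ≤ k := by positivity
      linarith
    rw [poch_succ, Nat.cast_succ, ← add_assoc, Complex.Gamma_add_one _ h, ih]; ring

end Pochhammer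

/-! ### The power series of `(1 - x²) ^ (-a)`. -/

/-- The coefficients of the even power series `(1 - x ^ 2) ^ (-a)`. -/
noncomputable def evenCoeff (a : ℝ) (k : ℕ) : ℝ :=
  if Even k then poch a (k / 2) / ((k / 2).factorial : ℝ) else 0

theorem evenCoeff_two_mul (a : ℝ) (m : ℕ) :
    evenCoeff a (2 * m) = poch a m / (m.factorial : ℝ) := by
  simp [evenCoeff]

/-- Coefficient comparison in `(1 - x²) ^ (-a) * (1 - x²) ^ (-b)`. Pairs with an odd entry
contribute nothing, and the others are the Chu–Vandermonde sum for half the index. -/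
theorem sum_antidiagonal_evenCoeff (a b : ℝ) (M : ℕ) :
    ∑ ij ∈ Finset.HasAntidiagonal.antidiagonal M, evenCoeff a ij.1 * evenCoeff b ij.2 = evenCoeff (a + b) M := by
  by_cases hM : Even M
  · obtain ⟨m, rfl⟩ := hM.two_dvd
    rw [evenCoeff_two_mul, poch_add_eq_sum, Finset.sum_div]
    symm
    refine Finset.sum_of_injOn (fun ij => (2 * ij.1, 2 * ij.2)) ?_ ?_ ?_ ?_
    · intro x _ y _ h
      simpa [Prod.ext_iff] using h
    · intro x hx
      have : x.1 + x.2 = m := by simpa using hx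
      simp [← this, mul_add]
    · intro x hx hx'
      have h : x.1 + x.2 = 2 * m := by simpa using hx
      by_cases h1 : Even x.1
      · obtain ⟨i, hi⟩ := h1.two_dvd
        exfalso
        refine hx' ⟨(i, m - i), ?_, ?_⟩
        · simp; omega
        · ext <;> simp <;> omega
      · simp [evenCoeff, h1]
    · intro x hx
      have h : x.1 + x.2 = m := by simpa using hx
      have h1 := Nat.choose_mul_factorial_mul_factorial (Nat.le.intro h)
      rw [show m - x.1 = x.2 by omega] at h1
      simp only [evenCoeff_two_mul]
      rw [← h1]
      have : m.choose x.1 ≠ 0 := (Nat.choose_pos (by omega)).ne'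
      push_cast
      field_simp
  · have hsum : evenCoeff (a + b) M = 0 := by simp [evenCoeff, hM]
    rw [hsum]
    refine Finset.sum_eq_zero fun x hx => ?_
    have h : x.1 + x.2 = M := by simpa using hx
    rw [← h, Nat.even_add] at hM
    by_cases h1 : Even x.1
    · have h2 : ¬ Even x.2 := fun h2 => hM (by simp [h1, h2])
      simp [evenCoeff, h2]
    · simp [evenCoeff, h1]

theorem evenCoeff_zero_left (k : ℕ) : evenCoeff 0 k = if k = 0 then 1 else 0 := by
  rcases Nat.eq_zero_or_pos k with rfl | hk
  · simp [evenCoeff]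
  · rw [if_neg hk.ne', evenCoeff]
    split_ifs with h
    · obtain ⟨m, rfl⟩ := h.two_dvd
      obtain ⟨l, rfl⟩ : ∃ l, m = l + 1 := ⟨m - 1, by omega⟩
      simp [poch, Finset.prod_range_succ']
    · rfl

theorem mk_evenCoeff_pow (a : ℝ) (n : ℕ) :
    (PowerSeries.mk (evenCoeff a)) ^ n = PowerSeries.mk (evenCoeff (n * a)) := by
  induction n with
  | zero =>
    ext k
    simp [evenCoeff_zero_left, PowerSeries.coeff_one]
  | succ n ih =>
    ext k
    rw [pow_succ, ih, PowerSeries.coeff_mul]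
    simp only [PowerSeries.coeff_mk]
    rw [sum_antidiagonal_evenCoeff]
    push_cast; ring_nf

/-- The left side is a coefficient of a product of `n` equal power series. This evaluates the
multinomial sum for the projected walk. -/
theorem sum_piAntidiag_prod_evenCoeff (n : ℕ) (a : ℝ) (M : ℕ) :
    ∑ k ∈ (Finset.univ : Finset (Fin n)).piAntidiag M, ∏ i, evenCoeff a (k i) =
      evenCoeff (n * a) M := by
  have h := congrArg (PowerSeries.coeff M) (mk_evenCoeff_pow a n)
  have hprod : (PowerSeries.mk (evenCoeff a)) ^ n =
      ∏ _i : Fin n, PowerSeries.mk (evenCoeff a) := by simp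
  rw [PowerSeries.coeff_mk, hprod, PowerSeries.coeff_prod] at h
  rw [← h]
  symm
  refine Finset.sum_bij (fun l _ => ⇑l) ?_ ?_ ?_ ?_
  · intro l hl
    rw [Finset.mem_finsuppAntidiag] at hl
    simpa using hl.1
  · intro _ _ _ _ h
    exact DFunLike.coe_injective h
  · intro k hk
    rw [Finset.mem_piAntidiag] at hk
    refine ⟨Finsupp.equivFunOnFinite.symm k, ?_, rfl⟩
    rw [Finset.mem_finsuppAntidiag]
    exact ⟨hk.1, Finset.subset_univ _⟩
  · intro l _
    simp

/-! ### Moments of the uniform distribution on the sphere. -/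

section Sphere

open Measure Module

/-- Polar coordinates for functions `x ↦ g (x / ‖x‖) φ (‖x‖)`. -/
theorem integral_eq_toSphere_mul {E : Type*} [NormedAddCommGroup E] [NormedSpace ℝ E]
    [Nontrivial E] [FiniteDimensional ℝ E] [MeasurableSpace E] [BorelSpace E] (μ : Measure E)
    [μ.IsAddHaarMeasure] (F g : E → ℝ) (φ : ℝ → ℝ)
    (hF : ∀ r : ℝ, 0 < r → ∀ u : E, ‖u‖ = 1 → F (r • u) = g u * φ r) :
    ∫ x, F x ∂μ = (∫ u : Metric.sphere (0 : E) 1, g u ∂μ.toSphere) *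
      ∫ r in Set.Ioi (0 : ℝ), r ^ (finrank ℝ E - 1) * φ r := by
  have hmp := (μ.measurePreserving_homeomorphUnitSphereProd).symm
    (homeomorphUnitSphereProd E).toMeasurableEquiv
  have h0 : ∫ x, F x ∂μ = ∫ x in {0}ᶜ, F x ∂μ := by rw [restrict_compl_singleton]
  rw [h0, ← integral_subtype_comap (measurableSet_singleton _).compl, ← hmp.integral_comp']
  have h1 : ∀ z : Metric.sphere (0 : E) 1 × Set.Ioi (0 : ℝ),
      F ((homeomorphUnitSphereProd E).toMeasurableEquiv.symm z : ({0}ᶜ : Set E)) =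
        g z.1 * φ z.2 := by
    intro z
    have : (((homeomorphUnitSphereProd E).toMeasurableEquiv.symm z : ({0}ᶜ : Set E)) : E) =
        (z.2 : ℝ) • (z.1 : E) := homeomorphUnitSphereProd_symm_apply_coe E z
    rw [this]
    exact hF _ z.2.2 _ (by simp)
  simp_rw [h1]
  rw [integral_prod_mul (fun u : Metric.sphere (0 : E) 1 => g u)
    (fun r : Set.Ioi (0 : ℝ) => φ r)]
  congr 1
  simp only [volumeIoiPow]
  rw [integral_withDensity_eq_integral_toReal_smul (by fun_prop) (by simp)]
  rw [integral_subtype_comap measurableSet_Ioi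
    (fun r : ℝ => (ENNReal.ofReal (r ^ (finrank ℝ E - 1))).toReal • φ r)]
  refine setIntegral_congr_fun measurableSet_Ioi fun r hr => ?_
  have : (0 : ℝ) ≤ r ^ (finrank ℝ E - 1) := pow_nonneg (le_of_lt hr) _
  simp [ENNReal.toReal_ofReal this]

theorem integral_Ioi_pow_mul_exp_neg_sq (k : ℕ) :
    ∫ r in Set.Ioi (0 : ℝ), r ^ k * Real.exp (-r ^ 2) = Real.Gamma (((k : ℝ) + 1) / 2) / 2 := by
  have h := integral_rpow_mul_exp_neg_rpow (p := 2) (q := k) (by norm_num)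
    (by have : (0 : ℝ) ≤ k := by positivity
        linarith)
  simp only [Real.rpow_natCast, Real.rpow_ofNat] at h
  rw [h]; ring

theorem integral_pow_mul_exp_neg_sq (k : ℕ) :
    ∫ r : ℝ, r ^ k * Real.exp (-r ^ 2) = if Even k then Real.Gamma (((k : ℝ) + 1) / 2) else 0 := by
  split_ifs with hk
  · have h : ∀ r : ℝ, r ^ k * Real.exp (-r ^ 2) = |r| ^ k * Real.exp (-|r| ^ 2) := fun r => by
      rw [hk.pow_abs, sq_abs]
    rw [integral_congr_ae (ae_of_all _ h)]
    rw [integral_comp_abs (f := fun r => r ^ k * Real.exp (-r ^ 2)),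
      integral_Ioi_pow_mul_exp_neg_sq]
    ring
  · have h := integral_neg_eq_self (fun r : ℝ => r ^ k * Real.exp (-r ^ 2)) volume
    have hk' : Odd k := by simpa using hk
    have h2 : ∀ r : ℝ, (-r) ^ k * Real.exp (-(-r) ^ 2) = -(r ^ k * Real.exp (-r ^ 2)) := fun r => by
      rw [hk'.neg_pow, even_two.neg_pow, neg_mul]
    rw [integral_congr_ae (ae_of_all _ h2), integral_neg] at h
    linarith

theorem integral_coord_pow_mul_exp_neg_norm_sq {d : ℕ} (i : Fin d) (k : ℕ) :
    ∫ x : EuclideanSpace ℝ (Fin d), x i ^ k * Real.exp (-‖x‖ ^ 2) =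
      (∫ r : ℝ, r ^ k * Real.exp (-r ^ 2)) * √Real.pi ^ (d - 1) := by
  rw [← (EuclideanSpace.volume_preserving_symm_measurableEquiv_toLp (Fin d)).symm.integral_comp']
  have h : ∀ y : Fin d → ℝ,
      ((MeasurableEquiv.toLp 2 (Fin d → ℝ)).symm.symm y) i ^ k *
        Real.exp (-‖(MeasurableEquiv.toLp 2 (Fin d → ℝ)).symm.symm y‖ ^ 2) =
      ∏ j, (if j = i then (fun r : ℝ => r ^ k * Real.exp (-r ^ 2))
        else fun r : ℝ => Real.exp (-r ^ 2)) (y j) := by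
    intro y
    rw [EuclideanSpace.norm_sq_eq, ← Finset.sum_neg_distrib, Real.exp_sum,
      ← Finset.mul_prod_erase Finset.univ _ (Finset.mem_univ i),
      ← Finset.mul_prod_erase Finset.univ _ (Finset.mem_univ i), ← mul_assoc]
    congr 1
    · simp
    · refine Finset.prod_congr rfl fun j hj => ?_
      rw [if_neg (Finset.ne_of_mem_erase hj)]
      simp
  simp_rw [h]
  rw [integral_fintype_prod_volume_eq_prod (fun j => (if j = i then
    (fun r : ℝ => r ^ k * Real.exp (-r ^ 2)) else fun r : ℝ => Real.exp (-r ^ 2))),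
    ← Finset.mul_prod_erase Finset.univ _ (Finset.mem_univ i)]
  congr 1
  · simp
  · have h3 : ∫ r : ℝ, Real.exp (-r ^ 2) = √Real.pi := by
      simpa using integral_gaussian 1
    rw [Finset.prod_congr rfl (g := fun _ => √Real.pi) fun j hj => by
      rw [if_neg (Finset.ne_of_mem_erase hj), h3]]
    simp [Finset.card_erase_of_mem]

/-- The moments of a coordinate of a uniform point of the unit sphere of `ℝᵈ`. -/
noncomputable def sphereMoment (d k : ℕ) : ℝ :=
  if Even k then poch (1 / 2 : ℝ) (k / 2) / poch ((d : ℝ) / 2) (k / 2) else 0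

theorem sphereMoment_two_mul (d m : ℕ) :
    sphereMoment d (2 * m) = poch (1 / 2 : ℝ) m / poch ((d : ℝ) / 2) m := by
  simp [sphereMoment]

variable {d : ℕ}

/-- The integral of `⟨u, x⟩ ^ k * exp (-‖x‖²)` over `ℝᵈ` is computed twice: polar coordinates
separate the sphere integral from a radial Gamma integral, and an orthonormal basis containing `u`
factors it into one-dimensional Gaussian integrals. The factor next to `sphereMoment d k` is the
area of the sphere. -/
theorem integral_toSphere_inner_pow (hd : 0 < d) {u : EuclideanSpace ℝ (Fin d)} (hu : ‖u‖ = 1)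
    (k : ℕ) :
    ∫ θ : Metric.sphere (0 : EuclideanSpace ℝ (Fin d)) 1, inner ℝ u (θ : EuclideanSpace ℝ (Fin d)) ^ k
        ∂(volume : Measure (EuclideanSpace ℝ (Fin d))).toSphere =
      sphereMoment d k * (2 * √Real.pi ^ d / Real.Gamma ((d : ℝ) / 2)) := by
  have hdim : finrank ℝ (EuclideanSpace ℝ (Fin d)) = d := by simp
  have : Nontrivial (EuclideanSpace ℝ (Fin d)) := by
    apply Module.nontrivial_of_finrank_pos (R := ℝ); rwa [hdim]
  let i : Fin d := ⟨0, hd⟩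
  obtain ⟨b, hb⟩ : ∃ b : OrthonormalBasis (Fin d) ℝ (EuclideanSpace ℝ (Fin d)), b i = u := by
    have ho : Orthonormal ℝ (({i} : Set (Fin d)).domRestrict (fun _ : Fin d => u)) := by
      constructor
      · intro _; simpa using hu
      · intro x y hxy
        exact absurd (Subsingleton.elim x y) hxy
    obtain ⟨b, hb⟩ := ho.exists_orthonormalBasis_extension_of_card_eq (by simp)
    exact ⟨b, hb i rfl⟩
  have h1 := integral_eq_toSphere_mul (volume : Measure (EuclideanSpace ℝ (Fin d)))
    (fun x => inner ℝ u x ^ k * Real.exp (-‖x‖ ^ 2)) (fun x => inner ℝ u x ^ k)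
    (fun r => r ^ k * Real.exp (-r ^ 2)) (fun r hr x hx => by
      simp only [inner_smul_right, norm_smul, hx, Real.norm_eq_abs, abs_of_pos hr]
      ring_nf)
  have h2 : ∫ x, inner ℝ u x ^ k * Real.exp (-‖x‖ ^ 2) =
      ∫ x : EuclideanSpace ℝ (Fin d), x i ^ k * Real.exp (-‖x‖ ^ 2) := by
    rw [← b.measurePreserving_repr.integral_comp b.repr.toHomeomorph.measurableEmbedding
      (fun x : EuclideanSpace ℝ (Fin d) => x i ^ k * Real.exp (-‖x‖ ^ 2))]
    simp [OrthonormalBasis.repr_apply_apply, hb]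
  rw [h2, integral_coord_pow_mul_exp_neg_norm_sq, integral_pow_mul_exp_neg_sq, hdim] at h1
  simp_rw [← mul_assoc, ← pow_add, integral_Ioi_pow_mul_exp_neg_sq] at h1
  have hcast : ((d - 1 + k : ℕ) : ℝ) + 1 = d + k := by
    rw [Nat.cast_add, Nat.cast_sub hd]; push_cast; ring
  rw [hcast] at h1
  have hd' : (0 : ℝ) < (d : ℝ) / 2 := by positivity
  have hG := Real.Gamma_pos_of_pos hd'
  have hpi : √Real.pi ^ d = √Real.pi * √Real.pi ^ (d - 1) := by
    rw [← pow_succ', Nat.sub_add_cancel hd]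
  have hGk : 0 < Real.Gamma (((d : ℝ) + k) / 2) := Real.Gamma_pos_of_pos (by positivity)
  rw [sphereMoment]
  split_ifs at h1 ⊢ with hk
  · obtain ⟨m, rfl⟩ := hk.two_dvd
    have e1 : (((2 * m : ℕ) : ℝ) + 1) / 2 = 1 / 2 + m := by push_cast; ring
    have e2 : ((d : ℝ) + (2 * m : ℕ)) / 2 = (d : ℝ) / 2 + m := by push_cast; ring
    rw [e1, e2, Real.Gamma_add_natCast (by norm_num), Real.Gamma_add_natCast hd',
      Real.Gamma_one_half_eq] at h1
    have hp := poch_pos hd' m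
    rw [show 2 * m / 2 = m by omega, hpi]
    field_simp
    linarith
  · rw [zero_mul] at h1 ⊢
    have := (mul_eq_zero.1 h1.symm).resolve_right (by positivity)
    exact this

theorem toSphere_real_univ (hd : 0 < d) :
    (volume : Measure (EuclideanSpace ℝ (Fin d))).toSphere.real Set.univ =
      2 * √Real.pi ^ d / Real.Gamma ((d : ℝ) / 2) := by
  have h := integral_toSphere_inner_pow hd
    (u := EuclideanSpace.single (⟨0, hd⟩ : Fin d) (1 : ℝ)) (by simp) 0
  simpa [sphereMoment] using h

theorem toSphere_univ_ne_zero (hd : 0 < d) :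
    (volume : Measure (EuclideanSpace ℝ (Fin d))).toSphere Set.univ ≠ 0 := by
  intro h
  have h1 := toSphere_real_univ hd
  rw [measureReal_def, h, ENNReal.toReal_zero] at h1
  have hG : 0 < Real.Gamma ((d : ℝ) / 2) := Real.Gamma_pos_of_pos (by positivity)
  have : 0 < 2 * √Real.pi ^ d / Real.Gamma ((d : ℝ) / 2) := by positivity
  linarith

theorem isProbabilityMeasure_uniformSphere (hd : 0 < d) :
    IsProbabilityMeasure (uniformSphere d) := by
  constructor
  rw [uniformSphere, Measure.smul_apply, Measure.map_apply measurable_subtype_coe MeasurableSet.univ,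
    Set.preimage_univ, smul_eq_mul]
  exact ENNReal.inv_mul_cancel (toSphere_univ_ne_zero hd) (measure_ne_top _ _)

theorem ae_uniformSphere_norm : ∀ᵐ θ ∂(uniformSphere d), ‖θ‖ = 1 := by
  refine Measure.ae_smul_measure ?_ _
  rw [ae_map_iff measurable_subtype_coe.aemeasurable
    (measurableSet_eq_fun (by fun_prop) (by fun_prop))]
  exact ae_of_all _ fun θ => by simp

theorem integral_uniformSphere (hd : 0 < d) {g : EuclideanSpace ℝ (Fin d) → ℝ}
    (hg : Measurable g) :
    ∫ θ, g θ ∂(uniformSphere d) = (2 * √Real.pi ^ d / Real.Gamma ((d : ℝ) / 2))⁻¹ *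
      ∫ θ : Metric.sphere (0 : EuclideanSpace ℝ (Fin d)) 1, g θ
        ∂(volume : Measure (EuclideanSpace ℝ (Fin d))).toSphere := by
  rw [uniformSphere, integral_smul_measure, integral_map measurable_subtype_coe.aemeasurable
    hg.aestronglyMeasurable, ENNReal.toReal_inv, ← measureReal_def, toSphere_real_univ hd,
    smul_eq_mul]

theorem integral_uniformSphere_inner_pow (hd : 0 < d) (w : EuclideanSpace ℝ (Fin d)) (k : ℕ) :
    ∫ θ, inner ℝ w θ ^ k ∂(uniformSphere d) = ‖w‖ ^ k * sphereMoment d k := by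
  have hG : 0 < Real.Gamma ((d : ℝ) / 2) := Real.Gamma_pos_of_pos (by positivity)
  have hunit : ∀ u : EuclideanSpace ℝ (Fin d), ‖u‖ = 1 →
      ∫ θ, inner ℝ u θ ^ k ∂(uniformSphere d) = sphereMoment d k := by
    intro u hu
    rw [integral_uniformSphere hd (by fun_prop), integral_toSphere_inner_pow hd hu]
    have : 0 < √Real.pi := Real.sqrt_pos.2 Real.pi_pos
    field_simp
  -- Homogeneity reduces nonzero `w` to a unit vector. For `w = 0` and `k = 0` both sides are `1`,
  -- by `0 ^ 0 = 1` and total mass one.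
  rcases eq_or_ne w 0 with rfl | hw
  · have := isProbabilityMeasure_uniformSphere hd
    rcases Nat.eq_zero_or_pos k with rfl | hk
    · simp [sphereMoment]
    · simp [hk.ne']
  · have hw' : ‖w‖ ≠ 0 := norm_ne_zero_iff.2 hw
    have h := hunit (‖w‖⁻¹ • w) (by rw [norm_smul, norm_inv, norm_norm, inv_mul_cancel₀ hw'])
    simp_rw [real_inner_smul_left, mul_pow] at h
    rw [integral_const_mul] at h
    rw [← h, ← mul_assoc, ← mul_pow, mul_inv_cancel₀ hw', one_pow, one_mul]

end Sphere

/-! ### Dirichlet's integral and the moments of the Dirichlet distribution. -/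

section Dirichlet

open scoped ENNReal

theorem lintegral_Ioo_rpow_mul_rpow {a b t : ℝ} (ha : 0 < a) (hb : 0 < b) (ht : 0 < t) :
    ∫⁻ y in Set.Ioo 0 t, ENNReal.ofReal (y ^ (a - 1) * (t - y) ^ (b - 1)) =
      ENNReal.ofReal (t ^ (a + b - 1) * (Real.Gamma a * Real.Gamma b / Real.Gamma (a + b))) := by
  have h1 := lintegral_betaPDF_eq_one ha hb
  have hB := beta_pos ha hb
  rw [lintegral_betaPDF] at h1
  simp_rw [mul_assoc] at h1
  have h2 : ∫⁻ x in Set.Ioo (0 : ℝ) 1, ENNReal.ofReal (x ^ (a - 1) * (1 - x) ^ (b - 1)) =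
      ENNReal.ofReal (beta a b) := by
    simp_rw [ENNReal.ofReal_mul (one_div_pos.2 hB).le] at h1
    rw [lintegral_const_mul _ (by fun_prop)] at h1
    rw [one_div, ENNReal.ofReal_inv_of_pos hB] at h1
    rw [← one_mul (∫⁻ x in Set.Ioo (0 : ℝ) 1, _),
      ← ENNReal.mul_inv_cancel (ENNReal.ofReal_pos.2 hB).ne' ENNReal.ofReal_ne_top, mul_assoc, h1,
      mul_one]
  have himg : (fun x => t * x) '' Set.Ioo (0 : ℝ) 1 = Set.Ioo 0 t := by
    rw [Set.image_mul_left_Ioo ht]; simp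
  rw [← himg, lintegral_image_eq_lintegral_abs_deriv_mul measurableSet_Ioo (f' := fun _ => t)
    (fun x _ => by simpa using ((hasDerivAt_id x).const_mul t).hasDerivWithinAt)
    (fun x _ y _ h => mul_left_cancel₀ ht.ne' h)]
  rw [setLIntegral_congr_fun (g := fun x => ENNReal.ofReal (t ^ (a + b - 1)) *
    ENNReal.ofReal (x ^ (a - 1) * (1 - x) ^ (b - 1))) measurableSet_Ioo, lintegral_const_mul _
      (by fun_prop), h2, ← ENNReal.ofReal_mul (by positivity), beta]
  intro x hx
  have hx1 : 0 < 1 - x := sub_pos.2 hx.2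
  simp only
  rw [← ENNReal.ofReal_mul (abs_nonneg _), ← ENNReal.ofReal_mul (by positivity), abs_of_pos ht,
    show t - t * x = t * (1 - x) by ring, Real.mul_rpow ht.le hx.1.le, Real.mul_rpow ht.le hx1.le,
    show a + b - 1 = 1 + (a - 1) + (b - 1) by ring, Real.rpow_add ht, Real.rpow_add ht,
    Real.rpow_one]
  congr 1; ring

/-- The unnormalized Dirichlet density on the simplex `{x | 0 < x i, ∑ x i < t}`. -/
noncomputable def dirichletKernel {m : ℕ} (q : Fin m → ℝ) (b t : ℝ) (x : Fin m → ℝ) : ℝ :=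
  open Classical in
  if (∀ i, 0 < x i) ∧ ∑ i, x i < t then
    (∏ i, x i ^ (q i - 1)) * (t - ∑ i, x i) ^ (b - 1)
  else 0

theorem measurable_dirichletKernel {m : ℕ} (q : Fin m → ℝ) (b : ℝ) :
    Measurable fun p : ℝ × (Fin m → ℝ) => dirichletKernel q b p.1 p.2 := by
  unfold dirichletKernel
  have h1 : MeasurableSet {p : ℝ × (Fin m → ℝ) | ∀ i, 0 < p.2 i} := by
    rw [Set.ofPred_forall]
    exact MeasurableSet.iInter fun i => measurableSet_lt measurable_const (by fun_prop)
  have h2 : MeasurableSet {p : ℝ × (Fin m → ℝ) | ∑ i, p.2 i < p.1} :=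
    measurableSet_lt (by fun_prop) (by fun_prop)
  exact Measurable.ite (h1.inter h2) (by fun_prop) measurable_const

theorem measurable_dirichletKernel_right {m : ℕ} (q : Fin m → ℝ) (b t : ℝ) :
    Measurable (dirichletKernel q b t) :=
  (measurable_dirichletKernel q b).comp (f := fun x => (t, x)) (by fun_prop)

theorem dirichletKernel_nonneg {m : ℕ} (q : Fin m → ℝ) (b t : ℝ) (x : Fin m → ℝ) :
    0 ≤ dirichletKernel q b t x := by
  unfold dirichletKernel
  split_ifs with h
  · have h1 := h.1
    have h2 := sub_pos.2 h.2
    exact mul_nonneg (Finset.prod_nonneg fun i _ => Real.rpow_nonneg (h1 i).le _)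
      (Real.rpow_nonneg h2.le _)
  · exact le_rfl

/-- Fixing the first coordinate leaves a kernel of the same kind on a simplex of size `t - y`; the
parameter `t` exists to make this recursion, and hence induction on `m`, possible. -/
theorem dirichletKernel_cons {m : ℕ} (q : Fin (m + 1) → ℝ) (b t y : ℝ) (x : Fin m → ℝ) :
    dirichletKernel q b t (Fin.cons y x) =
      (Set.Ioo 0 t).indicator (fun y => y ^ (q 0 - 1)) y *
        dirichletKernel (fun i => q i.succ) b (t - y) x := by
  unfold dirichletKernel
  by_cases hx : ∀ i, 0 < x i
  · have hs : 0 ≤ ∑ i, x i := Finset.sum_nonneg fun i _ => (hx i).le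
    by_cases hy : 0 < y
    · by_cases hlt : ∑ i, x i < t - y
      · have : y < t := by linarith
        rw [if_pos, if_pos ⟨hx, hlt⟩, Set.indicator_of_mem (Set.mem_Ioo.2 ⟨hy, this⟩)]
        · simp [Fin.prod_univ_succ, Fin.sum_univ_succ, sub_sub, mul_assoc]
        · simp only [Fin.forall_fin_succ, Fin.cons_zero, Fin.cons_succ, Fin.sum_univ_succ]
          exact ⟨⟨hy, hx⟩, by linarith⟩
      · rw [if_neg, if_neg (fun h => hlt h.2), mul_zero]
        simp only [Fin.sum_univ_succ, Fin.cons_zero, Fin.cons_succ]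
        intro h; apply hlt; linarith [h.2]
    · rw [if_neg, Set.indicator_of_notMem (fun h => hy h.1), zero_mul]
      intro h; exact hy (by simpa using h.1 0)
  · rw [if_neg, if_neg (fun h => hx h.1), mul_zero]
    intro h; exact hx fun i => by simpa using h.1 i.succ

/-- Dirichlet's integral. -/
theorem lintegral_dirichletKernel {m : ℕ} (q : Fin m → ℝ) (hq : ∀ i, 0 < q i) {b t : ℝ}
    (hb : 0 < b) (ht : 0 < t) :
    ∫⁻ x, ENNReal.ofReal (dirichletKernel q b t x) =
      ENNReal.ofReal (t ^ (∑ i, q i + b - 1) *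
        ((∏ i, Real.Gamma (q i)) * Real.Gamma b / Real.Gamma (∑ i, q i + b))) := by
  induction m generalizing b t with
  | zero =>
    have hG := (Real.Gamma_pos_of_pos hb).ne'
    simp [dirichletKernel, ht, hG, volume_pi]
  | succ m ih =>
    have hS : 0 ≤ ∑ i : Fin m, q i.succ := Finset.sum_nonneg fun i _ => (hq _).le
    rw [← (volume_preserving_piFinSuccAbove (fun _ : Fin (m + 1) => ℝ) 0).symm.lintegral_comp_emb
      (MeasurableEquiv.measurableEmbedding _)]
    have hcons : ∀ p : ℝ × (Fin m → ℝ),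
        (MeasurableEquiv.piFinSuccAbove (fun _ : Fin (m + 1) => ℝ) 0).symm p =
          Fin.cons p.1 p.2 := by
      intro p
      simp [MeasurableEquiv.piFinSuccAbove_symm_apply, Fin.consEquiv]
    simp_rw [hcons, dirichletKernel_cons]
    have hmeas : Measurable fun p : ℝ × (Fin m → ℝ) =>
        dirichletKernel (fun i => q i.succ) b (t - p.1) p.2 :=
      (measurable_dirichletKernel (fun i => q i.succ) b).comp
        (f := fun p : ℝ × (Fin m → ℝ) => (t - p.1, p.2)) (by fun_prop)
    have hind : Measurable ((Set.Ioo 0 t).indicator (fun y : ℝ => y ^ (q 0 - 1))) :=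
      Measurable.indicator (by fun_prop) measurableSet_Ioo
    have hprod : Measurable fun p : ℝ × (Fin m → ℝ) =>
        (Set.Ioo 0 t).indicator (fun y => y ^ (q 0 - 1)) p.1 *
          dirichletKernel (fun i => q i.succ) b (t - p.1) p.2 :=
      Measurable.mul (hind.comp measurable_fst) hmeas
    rw [Measure.volume_eq_prod, lintegral_prod _ hprod.ennreal_ofReal.aemeasurable]
    have hinner : ∀ y : ℝ, ∫⁻ x : Fin m → ℝ,
        ENNReal.ofReal ((Set.Ioo 0 t).indicator (fun y => y ^ (q 0 - 1)) y *
          dirichletKernel (fun i => q i.succ) b (t - y) x) =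
        (Set.Ioo 0 t).indicator (fun y => ENNReal.ofReal ((∏ i : Fin m, Real.Gamma (q i.succ)) *
          Real.Gamma b / Real.Gamma (∑ i : Fin m, q i.succ + b)) *
          ENNReal.ofReal (y ^ (q 0 - 1) * (t - y) ^ (∑ i : Fin m, q i.succ + b - 1))) y := by
      intro y
      by_cases hy : y ∈ Set.Ioo 0 t
      · rw [Set.indicator_of_mem hy, Set.indicator_of_mem hy]
        have hy0 : 0 ≤ y ^ (q 0 - 1) := Real.rpow_nonneg hy.1.le _
        have hG : 0 ≤ (∏ i : Fin m, Real.Gamma (q i.succ)) *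
            Real.Gamma b / Real.Gamma (∑ i : Fin m, q i.succ + b) := by
          have := Real.Gamma_pos_of_pos hb
          have := Real.Gamma_pos_of_pos (show 0 < ∑ i : Fin m, q i.succ + b by linarith)
          have : 0 ≤ ∏ i : Fin m, Real.Gamma (q i.succ) :=
            Finset.prod_nonneg fun i _ => (Real.Gamma_pos_of_pos (hq _)).le
          positivity
        simp_rw [ENNReal.ofReal_mul hy0]
        rw [lintegral_const_mul _ (measurable_dirichletKernel_right _ _ _).ennreal_ofReal,
          ih (fun i => q i.succ) (fun i => hq _) hb (sub_pos.2 hy.2), ← ENNReal.ofReal_mul hy0,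
          ← ENNReal.ofReal_mul hy0, ← ENNReal.ofReal_mul hG]
        congr 1; ring
      · simp [Set.indicator_of_notMem hy]
    -- What remains is a beta integral with parameters `q 0` and `∑ q i.succ + b`; the Gamma value
    -- at the latter cancels against the denominator from the induction hypothesis.
    simp_rw [hinner]
    rw [lintegral_indicator measurableSet_Ioo, lintegral_const_mul _ (by fun_prop),
      lintegral_Ioo_rpow_mul_rpow (hq 0) (by linarith) ht, Fin.sum_univ_succ, Fin.prod_univ_succ,
      mul_comm, ← ENNReal.ofReal_mul]
    · have := Real.Gamma_pos_of_pos (show 0 < ∑ i : Fin m, q i.succ + b by linarith)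
      rw [← add_assoc]
      congr 1
      field_simp
    · have := Real.Gamma_pos_of_pos (hq 0)
      have := Real.Gamma_pos_of_pos (show 0 < ∑ i : Fin m, q i.succ + b by linarith)
      have := Real.Gamma_pos_of_pos (show 0 < q 0 + (∑ i : Fin m, q i.succ + b) by
        linarith [hq 0])
      positivity

theorem integral_dirichletKernel {m : ℕ} (q : Fin m → ℝ) (hq : ∀ i, 0 < q i) {b : ℝ}
    (hb : 0 < b) :
    ∫ x, dirichletKernel q b 1 x =
      (∏ i, Real.Gamma (q i)) * Real.Gamma b / Real.Gamma (∑ i, q i + b) := by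
  rw [integral_eq_lintegral_of_nonneg_ae (ae_of_all _ (dirichletKernel_nonneg q b 1))
    (measurable_dirichletKernel_right q b 1).aestronglyMeasurable,
    lintegral_dirichletKernel q hq hb one_pos, ENNReal.toReal_ofReal, Real.one_rpow, one_mul]
  have hS : 0 ≤ ∑ i, q i := Finset.sum_nonneg fun i _ => (hq _).le
  have := Real.Gamma_pos_of_pos hb
  have := Real.Gamma_pos_of_pos (show 0 < ∑ i, q i + b by linarith)
  have : 0 ≤ ∏ i, Real.Gamma (q i) :=
    Finset.prod_nonneg fun i _ => (Real.Gamma_pos_of_pos (hq _)).le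
  rw [Real.one_rpow]
  positivity

theorem dirichletPDFReal_eq {m : ℕ} (q : Fin (m + 1) → ℝ) (x : Fin m → ℝ) :
    dirichletPDFReal q x = Real.Gamma (∑ i, q i) / (∏ i, Real.Gamma (q i)) *
      dirichletKernel (fun i => q i.castSucc) (q (Fin.last m)) 1 x := by
  unfold dirichletPDFReal dirichletKernel
  split_ifs <;> simp

theorem measurable_dirichletPDFReal {m : ℕ} (q : Fin (m + 1) → ℝ) :
    Measurable (dirichletPDFReal q) := by
  rw [show dirichletPDFReal q = _ from funext (dirichletPDFReal_eq q)]
  exact (measurable_dirichletKernel_right _ _ _).const_mul _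

theorem dirichletPDFReal_nonneg {m : ℕ} {q : Fin (m + 1) → ℝ} (hq : ∀ i, 0 < q i)
    (x : Fin m → ℝ) : 0 ≤ dirichletPDFReal q x := by
  rw [dirichletPDFReal_eq]
  exact mul_nonneg (div_nonneg (Real.Gamma_nonneg_of_nonneg
    (Finset.sum_nonneg fun i _ => (hq i).le))
    (Finset.prod_nonneg fun i _ => (Real.Gamma_pos_of_pos (hq _)).le)) (dirichletKernel_nonneg _ _ _ _)

/-- A monomial only shifts the Dirichlet parameters, so every mixed moment is a ratio of two
normalizing constants. -/
theorem dirichletKernel_mul_prod_pow {m : ℕ} (q : Fin (m + 1) → ℝ) (k : Fin (m + 1) → ℕ)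
    (x : Fin m → ℝ) :
    dirichletKernel (fun i => q i.castSucc) (q (Fin.last m)) 1 x * ∏ i, simplexPoint x i ^ k i =
      dirichletKernel (fun i => q i.castSucc + k i.castSucc)
        (q (Fin.last m) + k (Fin.last m)) 1 x := by
  unfold dirichletKernel
  split_ifs with h
  · have h2 := sub_pos.2 h.2
    rw [Fin.prod_univ_castSucc]
    simp only [simplexPoint, Fin.snoc_castSucc, Fin.snoc_last]
    have h3 : ∀ {y : ℝ}, 0 < y → ∀ (a : ℝ) (l : ℕ), y ^ (a + l - 1) = y ^ (a - 1) * y ^ l := by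
      intro y hy a l
      rw [← Real.rpow_natCast, ← Real.rpow_add hy]; congr 1; ring
    rw [h3 h2, Finset.prod_congr rfl fun i _ => h3 (h.1 i) (q i.castSucc) (k i.castSucc),
      Finset.prod_mul_distrib]
    ring
  · simp

/-- The mixed moments of the Dirichlet distribution. -/
theorem integral_dirichletMeasure_prod_pow {n : ℕ} (hn : 0 < n) (q : Fin n → ℝ)
    (hq : ∀ i, 0 < q i) (k : Fin n → ℕ) :
    ∫ x, ∏ i, x i ^ k i ∂(dirichletMeasure n q) =
      (∏ i, poch (q i) (k i)) / poch (∑ i, q i) (∑ i, k i) := by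
  obtain ⟨m, rfl⟩ : ∃ m, n = m + 1 := ⟨n - 1, by omega⟩
  rw [dirichletMeasure, integral_map measurable_simplexPoint.aemeasurable
    (by fun_prop : Continuous fun x : Fin (m + 1) → ℝ => ∏ i, x i ^ k i).aestronglyMeasurable,
    integral_withDensity_eq_integral_toReal_smul
      (measurable_dirichletPDFReal q).ennreal_ofReal (by simp)]
  have hint : ∀ x : Fin m → ℝ, (ENNReal.ofReal (dirichletPDFReal q x)).toReal •
      ∏ i, simplexPoint x i ^ k i = Real.Gamma (∑ i, q i) / (∏ i, Real.Gamma (q i)) *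
        dirichletKernel (fun i => q i.castSucc + k i.castSucc)
        (q (Fin.last m) + k (Fin.last m)) 1 x := by
    intro x
    rw [ENNReal.toReal_ofReal (dirichletPDFReal_nonneg hq x), dirichletPDFReal_eq, smul_eq_mul,
      mul_assoc, dirichletKernel_mul_prod_pow]
  simp_rw [hint]
  have hpos : ∀ i, 0 < q i + k i := fun i => add_pos_of_pos_of_nonneg (hq i) (by positivity)
  have hsum : 0 < ∑ i, q i := Finset.sum_pos (fun i _ => hq i) ⟨0, Finset.mem_univ _⟩
  rw [integral_const_mul, integral_dirichletKernel _ (fun i => hpos _) (hpos _),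
    ← Fin.prod_univ_castSucc (fun i => Real.Gamma (q i + k i)),
    ← Fin.sum_univ_castSucc (fun i => q i + (k i : ℝ)), Finset.sum_add_distrib, ← Nat.cast_sum,
    Real.Gamma_add_natCast hsum,
    Finset.prod_congr rfl fun i _ => Real.Gamma_add_natCast (hq i) (k i), Finset.prod_mul_distrib]
  have h1 : 0 < ∏ i, Real.Gamma (q i) :=
    Finset.prod_pos fun i _ => Real.Gamma_pos_of_pos (hq i)
  have h2 := Real.Gamma_pos_of_pos hsum
  have h3 := poch_pos hsum (∑ i, k i)
  field_simp

theorem ae_dirichletMeasure {n : ℕ} (q : Fin n → ℝ) :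
    ∀ᵐ x ∂(dirichletMeasure n q), (∀ i, 0 ≤ x i) ∧ ∑ i, x i = 1 := by
  cases n with
  | zero => simp [dirichletMeasure]
  | succ m =>
    have hms : MeasurableSet {x : Fin (m + 1) → ℝ | (∀ i, 0 ≤ x i) ∧ ∑ i, x i = 1} := by
      have h1 : MeasurableSet {x : Fin (m + 1) → ℝ | ∀ i, 0 ≤ x i} := by
        rw [Set.ofPred_forall]
        exact MeasurableSet.iInter fun i => measurableSet_le measurable_const (by fun_prop)
      exact h1.inter (measurableSet_eq_fun (by fun_prop) (by fun_prop))
    rw [dirichletMeasure, ae_map_iff measurable_simplexPoint.aemeasurable hms,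
      ae_withDensity_iff (measurable_dirichletPDFReal q).ennreal_ofReal]
    refine ae_of_all _ fun x hx => ?_
    have h : (∀ i, 0 < x i) ∧ ∑ i, x i < 1 := by
      by_contra h
      exact hx (by simp [dirichletPDFReal, h])
    constructor
    · refine Fin.lastCases ?_ fun i => ?_
      · simpa [simplexPoint] using h.2.le
      · simpa [simplexPoint] using (h.1 i).le
    · simp [Fin.sum_univ_castSucc, simplexPoint]

end Dirichlet

/-! ### Moments of the end point of the walk. -/

section Walk

variable {Ω : Type*} [MeasurableSpace Ω] {P : Measure Ω} {n d : ℕ}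
  {q : Fin n → ℝ} {X : Ω → Fin n → ℝ} {Θ : Fin n → Ω → EuclideanSpace ℝ (Fin d)}

theorem IsDirichletWalk.ae_weights (hW : IsDirichletWalk P q X Θ) :
    ∀ᵐ ω ∂P, (∀ i, 0 ≤ X ω i) ∧ ∑ i, X ω i = 1 := by
  refine ae_of_ae_map (p := fun x => (∀ i, 0 ≤ x i) ∧ ∑ i, x i = 1) hW.law_weights.aemeasurable ?_
  rw [hW.law_weights.map_eq]
  exact ae_dirichletMeasure q

theorem IsDirichletWalk.ae_directions (hW : IsDirichletWalk P q X Θ) :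
    ∀ᵐ ω ∂P, ∀ i, ‖Θ i ω‖ = 1 := by
  rw [ae_all_iff]
  intro i
  refine ae_of_ae_map (p := fun θ => ‖θ‖ = 1) (hW.law_directions i).aemeasurable ?_
  rw [(hW.law_directions i).map_eq]
  exact ae_uniformSphere_norm

theorem IsDirichletWalk.ae_norm_walkEnd_le (hW : IsDirichletWalk P q X Θ) :
    ∀ᵐ ω ∂P, ‖walkEnd X Θ ω‖ ≤ 1 := by
  filter_upwards [hW.ae_weights, hW.ae_directions] with ω h1 h2
  calc ‖walkEnd X Θ ω‖ ≤ ∑ i, ‖X ω i • Θ i ω‖ := norm_sum_le _ _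
    _ = ∑ i, X ω i := Finset.sum_congr rfl fun i _ => by
        rw [norm_smul, h2 i, mul_one, Real.norm_of_nonneg (h1.1 i)]
    _ = 1 := h1.2
    _ ≤ 1 := le_rfl

theorem IsDirichletWalk.aemeasurable_walkEnd (hW : IsDirichletWalk P q X Θ) :
    AEMeasurable (walkEnd X Θ) P := by
  unfold walkEnd
  refine Finset.aemeasurable_fun_sum _ fun i _ => ?_
  exact ((aemeasurable_pi_iff.1 hW.law_weights.aemeasurable) i).smul
    (hW.law_directions i).aemeasurable

/-- In generating functions, `E (1 - x⟨u, Θ⟩) ^ (-d) = (1 - x²) ^ (-(d + 1) / 2)` for a unit vector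
`u`. It follows by duplicating both `(d)_{2m}` and `(2m)! = (1)_{2m}`: the factors `(d / 2)_m` and
`(1 / 2)_m` of the sphere moment cancel. -/
theorem factorial_mul_poch_mul_sphereMoment (hd : 0 < d) (k : ℕ) :
    poch (d : ℝ) k * sphereMoment d k = k.factorial * evenCoeff (((d : ℝ) + 1) / 2) k := by
  by_cases hk : Even k
  · obtain ⟨m, rfl⟩ := hk.two_dvd
    have h1 := poch_two_mul (1 : ℝ) m
    rw [poch_one, show ((1 : ℝ) + 1) / 2 = 1 by norm_num, poch_one] at h1
    have h2 := poch_pos (show (0 : ℝ) < (d : ℝ) / 2 by positivity) m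
    rw [sphereMoment_two_mul, evenCoeff_two_mul, poch_two_mul, h1]
    have h3 := m.factorial_ne_zero
    field_simp
  · simp [sphereMoment, evenCoeff, hk]

/-- The denominator of a mixed Dirichlet moment depends only on the total degree `M`, so it leaves
the multinomial sum. The multinomial coefficient contributes `M! / ∏ (k i)!`, and the rest factors
over the steps into coefficients of the even series. -/
theorem IsDirichletWalk.integral_inner_pow [IsProbabilityMeasure P] (hn : 0 < n) (hd : 0 < d)
    (hW : IsDirichletWalk P (fun _ => (d : ℝ)) X Θ) {u : EuclideanSpace ℝ (Fin d)} (hu : ‖u‖ = 1)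
    (M : ℕ) :
    ∫ ω, inner ℝ u (walkEnd X Θ ω) ^ M ∂P =
      M.factorial * evenCoeff (n * (((d : ℝ) + 1) / 2)) M / poch ((n : ℝ) * d) M := by
  have hX := hW.law_weights.aemeasurable
  have hT := fun i => (hW.law_directions i).aemeasurable
  have hXk : ∀ k : Fin n → ℕ, AEStronglyMeasurable (fun ω => ∏ i, X ω i ^ k i) P := fun k =>
    ((by fun_prop : Measurable fun x : Fin n → ℝ => ∏ i, x i ^ k i).comp_aemeasurable
      hX).aestronglyMeasurable
  have hTk : ∀ k : Fin n → ℕ, AEStronglyMeasurable (fun ω => ∏ i, inner ℝ u (Θ i ω) ^ k i) P :=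
    fun k => ((by fun_prop : Measurable fun x : Fin n → EuclideanSpace ℝ (Fin d) =>
      ∏ i, inner ℝ u (x i) ^ k i).comp_aemeasurable
      (aemeasurable_pi_iff.2 hT)).aestronglyMeasurable
  have hexp : ∀ ω, inner ℝ u (walkEnd X Θ ω) ^ M =
      ∑ k ∈ (Finset.univ : Finset (Fin n)).piAntidiag M,
        (Nat.multinomial Finset.univ k : ℝ) *
          ((∏ i, X ω i ^ k i) * ∏ i, inner ℝ u (Θ i ω) ^ k i) := by
    intro ω
    simp_rw [walkEnd, inner_sum, inner_smul_right, Finset.sum_pow_eq_sum_piAntidiag, mul_pow,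
      Finset.prod_mul_distrib]
  have hint : ∀ k : Fin n → ℕ,
      Integrable (fun ω => (∏ i, X ω i ^ k i) * ∏ i, inner ℝ u (Θ i ω) ^ k i) P := by
    intro k
    refine Integrable.of_bound ((hXk k).mul (hTk k)) 1 ?_
    filter_upwards [hW.ae_weights, hW.ae_directions] with ω h1 h2
    rw [← Finset.prod_mul_distrib, norm_prod]
    refine Finset.prod_le_one (fun _ _ => norm_nonneg _) fun i _ => ?_
    have hx : X ω i ≤ 1 := h1.2 ▸ Finset.single_le_sum (fun j _ => h1.1 j) (Finset.mem_univ i)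
    rw [← mul_pow, norm_pow, norm_mul, Real.norm_of_nonneg (h1.1 i)]
    refine pow_le_one₀ (mul_nonneg (h1.1 i) (norm_nonneg _)) ?_
    refine mul_le_one₀ hx (norm_nonneg _) ?_
    calc ‖inner ℝ u (Θ i ω)‖ ≤ ‖u‖ * ‖Θ i ω‖ := norm_inner_le_norm _ _
      _ = 1 := by rw [hu, h2 i, one_mul]
  have hterm : ∀ k ∈ (Finset.univ : Finset (Fin n)).piAntidiag M,
      ∫ ω, (Nat.multinomial Finset.univ k : ℝ) *
          ((∏ i, X ω i ^ k i) * ∏ i, inner ℝ u (Θ i ω) ^ k i) ∂P =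
        M.factorial / poch ((n : ℝ) * d) M * ∏ i, evenCoeff (((d : ℝ) + 1) / 2) (k i) := by
    intro k hk
    have hsum : ∑ i, k i = M := (Finset.mem_piAntidiag.1 hk).1
    have hind : IndepFun (fun ω => ∏ i, X ω i ^ k i)
        (fun ω => ∏ i, inner ℝ u (Θ i ω) ^ k i) P :=
      hW.indep_weights.comp (φ := fun x : Fin n → ℝ => ∏ i, x i ^ k i)
        (ψ := fun x : Fin n → EuclideanSpace ℝ (Fin d) => ∏ i, inner ℝ u (x i) ^ k i)
        (by fun_prop) (by fun_prop)
    have hEX : ∫ ω, ∏ i, X ω i ^ k i ∂P = (∏ i, poch (d : ℝ) (k i)) / poch ((n : ℝ) * d) M := by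
      have := hW.law_weights.integral_comp (f := fun x : Fin n → ℝ => ∏ i, x i ^ k i)
        (by fun_prop : Continuous fun x : Fin n → ℝ => ∏ i, x i ^ k i).aestronglyMeasurable
      rw [integral_dirichletMeasure_prod_pow hn _ (fun _ => by positivity), hsum] at this
      simpa [Function.comp_def] using this
    have hET : ∫ ω, ∏ i, inner ℝ u (Θ i ω) ^ k i ∂P = ∏ i, sphereMoment d (k i) := by
      rw [hW.indep_directions.integral_fun_prod_comp (f := fun i θ => inner ℝ u θ ^ k i) hT
        (fun i => (by fun_prop : Continuous fun θ : EuclideanSpace ℝ (Fin d) =>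
          inner ℝ u θ ^ k i).aestronglyMeasurable)]
      refine Finset.prod_congr rfl fun i _ => ?_
      have := (hW.law_directions i).integral_comp (f := fun θ => inner ℝ u θ ^ k i)
        (by fun_prop : Continuous fun θ : EuclideanSpace ℝ (Fin d) =>
          inner ℝ u θ ^ k i).aestronglyMeasurable
      rw [integral_uniformSphere_inner_pow hd, hu, one_pow, one_mul] at this
      simpa [Function.comp_def] using this
    have hmul : (∏ i, ((k i).factorial : ℝ)) * (Nat.multinomial Finset.univ k : ℝ) =
        M.factorial := by
      rw [← hsum]; exact_mod_cast Nat.multinomial_spec Finset.univ k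
    rw [integral_const_mul, hind.integral_fun_mul_eq_mul_integral (hXk k) (hTk k), hEX, hET,
      div_mul_eq_mul_div, ← Finset.prod_mul_distrib,
      Finset.prod_congr rfl fun i _ => factorial_mul_poch_mul_sphereMoment hd (k i),
      Finset.prod_mul_distrib, ← hmul]
    ring
  simp_rw [hexp]
  rw [integral_finsetSum _ fun k _ => (hint k).const_mul _, Finset.sum_congr rfl hterm,
    ← Finset.mul_sum, sum_piAntidiag_prod_evenCoeff]
  ring

/-- The moments of the squared distance from the origin of the end point of the walk. -/
theorem IsDirichletWalk.integral_norm_sq_pow [IsProbabilityMeasure P] (hn : 0 < n) (hd : 0 < d)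
    (hW : IsDirichletWalk P (fun _ => (d : ℝ)) X Θ) (m : ℕ) :
    ∫ ω, (‖walkEnd X Θ ω‖ ^ 2) ^ m ∂P =
      poch ((n : ℝ) * (d + 1) / 2) m * poch ((d : ℝ) / 2) m /
        (poch (((n : ℝ) * d + 1) / 2) m * poch ((n : ℝ) * d / 2) m) := by
  have := isProbabilityMeasure_uniformSphere hd
  have hmeas := hW.aemeasurable_walkEnd
  -- The double integral of `⟨W, θ⟩ ^ (2m)` over an independent uniform `θ` is evaluated in both
  -- orders: `θ` first gives `E‖W‖ ^ (2m)` times a sphere moment, `ω` first gives a constant. The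
  -- exponent is even because odd sphere moments vanish.
  have hint : Integrable (Function.uncurry fun ω θ => inner ℝ (walkEnd X Θ ω) θ ^ (2 * m))
      (P.prod (uniformSphere d)) := by
    refine Integrable.of_bound ?_ 1 ?_
    · exact ((hmeas.aestronglyMeasurable.comp_fst).inner
        (aestronglyMeasurable_id.comp_snd)).pow _
    · filter_upwards [Measure.quasiMeasurePreserving_fst.ae hW.ae_norm_walkEnd_le,
        Measure.quasiMeasurePreserving_snd.ae (ae_uniformSphere_norm (d := d))] with p h1 h2
      rw [Function.uncurry_apply_pair, norm_pow]
      refine pow_le_one₀ (norm_nonneg _) ?_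
      calc ‖inner ℝ (walkEnd X Θ p.1) p.2‖ ≤ ‖walkEnd X Θ p.1‖ * ‖p.2‖ := norm_inner_le_norm _ _
        _ ≤ 1 := by rw [h2, mul_one]; exact h1
  have hswap := integral_integral_swap hint
  simp_rw [integral_uniformSphere_inner_pow hd] at hswap
  have hright : ∀ᵐ θ ∂(uniformSphere d), ∫ ω, inner ℝ (walkEnd X Θ ω) θ ^ (2 * m) ∂P =
      (2 * m).factorial * evenCoeff (n * (((d : ℝ) + 1) / 2)) (2 * m) /
        poch ((n : ℝ) * d) (2 * m) := by
    filter_upwards [ae_uniformSphere_norm (d := d)] with θ hθ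
    simp_rw [real_inner_comm θ]
    exact hW.integral_inner_pow hn hd hθ (2 * m)
  rw [integral_congr_ae hright, integral_mul_const, integral_const] at hswap
  simp only [probReal_univ, one_smul] at hswap
  have h1 := poch_two_mul (1 : ℝ) m
  rw [poch_one, show ((1 : ℝ) + 1) / 2 = 1 by norm_num, poch_one] at h1
  rw [h1, evenCoeff_two_mul, sphereMoment_two_mul, poch_two_mul] at hswap
  simp_rw [← pow_mul]
  have p1 := poch_pos (show (0 : ℝ) < (d : ℝ) / 2 by positivity) m
  have p2 := poch_pos (show (0 : ℝ) < 1 / 2 by norm_num) m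
  have p3 := poch_pos (show (0 : ℝ) < ((n : ℝ) * d + 1) / 2 by positivity) m
  have p4 := poch_pos (show (0 : ℝ) < (n : ℝ) * d / 2 by positivity) m
  have h3 := m.factorial_ne_zero
  field_simp at hswap
  rw [hswap, mul_comm (d : ℝ) n]
  ring

end Walk

/-! ### The moment problem on the unit interval. -/

section Moments

theorem integrable_pow_of_ae_mem_Icc {ρ : Measure ℝ} [IsFiniteMeasure ρ]
    (hρ : ∀ᵐ x ∂ρ, x ∈ Set.Icc (0 : ℝ) 1) (m : ℕ) : Integrable (fun x : ℝ => x ^ m) ρ := by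
  refine Integrable.of_bound (by fun_prop) 1 ?_
  filter_upwards [hρ] with x hx
  rw [norm_pow, Real.norm_of_nonneg hx.1]
  exact pow_le_one₀ hx.1 hx.2

/-- A finite measure on `[0, 1]` is determined by its moments. -/
theorem MeasureTheory.Measure.ext_of_moments {μ ν : Measure ℝ} [IsFiniteMeasure μ]
    [IsFiniteMeasure ν] (hμ : ∀ᵐ x ∂μ, x ∈ Set.Icc (0 : ℝ) 1) (hν : ∀ᵐ x ∂ν, x ∈ Set.Icc (0 : ℝ) 1)
    (h : ∀ m : ℕ, ∫ x, x ^ m ∂μ = ∫ x, x ^ m ∂ν) : μ = ν := by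
  have hpint : ∀ (ρ : Measure ℝ) [IsFiniteMeasure ρ], (∀ᵐ x ∂ρ, x ∈ Set.Icc (0 : ℝ) 1) →
      ∀ p : Polynomial ℝ, Integrable (fun x : ℝ => p.eval x) ρ := by
    intro ρ _ hρ p
    simp_rw [Polynomial.eval_eq_sum_range]
    exact integrable_finsetSum _ fun i _ => (integrable_pow_of_ae_mem_Icc hρ i).const_mul _
  have hp : ∀ p : Polynomial ℝ, ∫ x, p.eval x ∂μ = ∫ x, p.eval x ∂ν := by
    intro p
    simp_rw [Polynomial.eval_eq_sum_range]
    rw [integral_finsetSum _ fun i _ => (integrable_pow_of_ae_mem_Icc hμ i).const_mul _,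
      integral_finsetSum _ fun i _ => (integrable_pow_of_ae_mem_Icc hν i).const_mul _]
    simp_rw [integral_const_mul, h]
  refine ext_of_forall_integral_eq_of_IsFiniteMeasure fun g => ?_
  have happ : ∀ (ρ : Measure ℝ) [IsFiniteMeasure ρ], (∀ᵐ x ∂ρ, x ∈ Set.Icc (0 : ℝ) 1) →
      ∀ ε : ℝ, ∀ p : Polynomial ℝ, (∀ x ∈ Set.Icc (0 : ℝ) 1, |p.eval x - g x| < ε) →
      |(∫ x, p.eval x ∂ρ) - ∫ x, g x ∂ρ| ≤ ε * ρ.real Set.univ := by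
    intro ρ _ hρ ε p hpg
    rw [← integral_sub (hpint ρ hρ p) (g.integrable ρ), ← Real.norm_eq_abs]
    refine norm_integral_le_of_norm_le_const ?_
    filter_upwards [hρ] with x hx
    exact (hpg x hx).le
  rw [← sub_eq_zero, ← abs_eq_zero]
  refine le_antisymm (le_of_forall_pos_le_add fun δ hδ => ?_) (abs_nonneg _)
  set K : ℝ := μ.real Set.univ + ν.real Set.univ with hK
  have hK0 : 0 ≤ K := add_nonneg measureReal_nonneg measureReal_nonneg
  -- Weierstrass approximation. With `K` the sum of the two total masses, the accuracy `δ / (K + 1)`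
  -- keeps the combined error below `δ`, also when `K = 0`.
  obtain ⟨p, hpg⟩ := exists_polynomial_near_of_continuousOn 0 1 g g.continuous.continuousOn
    (δ / (K + 1)) (by positivity)
  have h1 := happ μ hμ _ p hpg
  have h2 := happ ν hν _ p hpg
  rw [hp p] at h1
  have h3 : δ / (K + 1) * K ≤ δ := by
    rw [div_mul_eq_mul_div, div_le_iff₀ (by positivity)]
    nlinarith
  rw [abs_le] at h1 h2 ⊢
  constructor <;> nlinarith [h1.1, h1.2, h2.1, h2.2]

/-- If the moments of a measure on `[0, 1]` are those of an integrable function on `(0, 1)`, then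
this function is a density of the measure. -/
theorem eq_withDensity_of_moments {μ : Measure ℝ} [IsFiniteMeasure μ]
    (hμ : ∀ᵐ x ∂μ, x ∈ Set.Icc (0 : ℝ) 1) {g : ℝ → ℝ} (hg : Measurable g)
    (hint : IntegrableOn g (Set.Ioo 0 1))
    (h : ∀ m : ℕ, ∫ x, x ^ m ∂μ = ∫ x in Set.Ioo (0 : ℝ) 1, g x * x ^ m) :
    μ = volume.withDensity (fun x => ENNReal.ofReal ((Set.Ioo (0 : ℝ) 1).indicator g x)) ∧
      ∀ᵐ x, 0 ≤ (Set.Ioo (0 : ℝ) 1).indicator g x := by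
  set G := (Set.Ioo (0 : ℝ) 1).indicator g with hG
  have hGm : Measurable G := hg.indicator measurableSet_Ioo
  have hGn : Measurable fun x => -G x := hGm.neg
  have hGi : Integrable G := (integrable_indicator_iff measurableSet_Ioo).2 hint
  have hfin : ∀ F : ℝ → ℝ, Integrable F →
      IsFiniteMeasure (volume.withDensity fun x => ENNReal.ofReal (F x)) := fun F hF =>
    isFiniteMeasure_withDensity_ofReal hF.2
  have := hfin G hGi
  have := hfin (fun x => -G x) hGi.neg
  have hsupp : ∀ F : ℝ → ℝ, Measurable F → (∀ x, x ∉ Set.Ioo (0 : ℝ) 1 → F x = 0) →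
      ∀ᵐ x ∂(volume.withDensity fun x => ENNReal.ofReal (F x)), x ∈ Set.Icc (0 : ℝ) 1 := by
    intro F hF h0
    rw [ae_withDensity_iff hF.ennreal_ofReal]
    refine ae_of_all _ fun x hx => Set.Ioo_subset_Icc_self ?_
    by_contra hx'
    exact hx (by simp [h0 x hx'])
  have hG0 : ∀ x, x ∉ Set.Ioo (0 : ℝ) 1 → G x = 0 := fun x hx => Set.indicator_of_notMem hx _
  have hs1 := hsupp G hGm hG0
  have hs2 := hsupp (fun x => -G x) hGn fun x hx => by simp [hG0 x hx]
  have hmom : ∀ F : ℝ → ℝ, Measurable F → ∀ m : ℕ,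
      ∫ x, x ^ m ∂(volume.withDensity fun x => ENNReal.ofReal (F x)) =
        ∫ x, max (F x) 0 * x ^ m := by
    intro F hF m
    rw [integral_withDensity_eq_integral_toReal_smul hF.ennreal_ofReal (by simp)]
    simp [ENNReal.toReal_ofReal']
  have hI : ∀ F : ℝ → ℝ, Integrable F → (∀ x, x ∉ Set.Ioo (0 : ℝ) 1 → F x = 0) → ∀ m : ℕ,
      Integrable (fun x => max (F x) 0 * x ^ m) := by
    intro F hF h0 m
    refine Integrable.mono' hF.norm ?_ (ae_of_all _ fun x => ?_)
    · exact (hF.1.sup aestronglyMeasurable_const).mul (by fun_prop)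
    · by_cases hx : x ∈ Set.Ioo (0 : ℝ) 1
      · rw [norm_mul, norm_pow, Real.norm_of_nonneg hx.1.le]
        refine (mul_le_of_le_one_right (norm_nonneg _) (pow_le_one₀ hx.1.le hx.2.le)).trans ?_
        rw [Real.norm_of_nonneg (le_max_right _ _)]
        exact max_le (le_abs_self _) (norm_nonneg _)
      · simp [h0 x hx]
  -- The sign of `g` is not known in advance (the odd case has alternating coefficients), so its
  -- negative part is moved to the side of `μ`; both sides are then finite measures on `[0, 1]` with
  -- equal moments.
  have heq : μ + volume.withDensity (fun x => ENNReal.ofReal (-G x)) =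
      volume.withDensity (fun x => ENNReal.ofReal (G x)) := by
    refine Measure.ext_of_moments (ae_add_measure_iff.2 ⟨hμ, hs2⟩) hs1 fun m => ?_
    rw [integral_add_measure (integrable_pow_of_ae_mem_Icc hμ m) (integrable_pow_of_ae_mem_Icc hs2 m),
      h, hmom _ hGn, hmom _ hGm,
      ← integral_indicator measurableSet_Ioo, ← eq_sub_iff_add_eq,
      ← integral_sub (hI G hGi hG0 m) (hI (fun x => -G x) hGi.neg (fun x hx => by simp [hG0 x hx]) m)]
    refine integral_congr_ae (ae_of_all _ fun x => ?_)
    simp only [Set.indicator_mul_left, ← hG]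
    rw [← sub_mul]
    congr 1
    rcases le_total 0 (G x) with hx | hx
    · rw [max_eq_left hx, max_eq_right (by linarith), sub_zero]
    · rw [max_eq_right hx, max_eq_left (by linarith)]; ring
  -- The right side of `heq` is carried by `{G > 0}`, hence so is the summand with density `-G`,
  -- which is carried by `{G < 0}`. The negative part is thus null.
  have hpos : ∀ᵐ x, 0 ≤ G x := by
    have h1 : ∀ᵐ x ∂(volume.withDensity fun x => ENNReal.ofReal (G x)), 0 < G x := by
      rw [ae_withDensity_iff hGm.ennreal_ofReal]
      refine ae_of_all _ fun x hx => ?_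
      simpa using hx
    rw [← heq, ae_add_measure_iff] at h1
    have h2 := h1.2
    rw [ae_withDensity_iff hGn.ennreal_ofReal] at h2
    filter_upwards [h2] with x hx
    by_contra hneg
    push Not at hneg
    have := hx (by simpa using hneg)
    linarith
  refine ⟨?_, hpos⟩
  rw [← heq]
  have hzero : volume.withDensity (fun x => ENNReal.ofReal (-G x)) = 0 := by
    rw [withDensity_eq_zero_iff hGn.ennreal_ofReal.aemeasurable]
    filter_upwards [hpos] with x hx
    simpa using hx
  rw [hzero, add_zero]

end Moments

/-! ### Mellin transforms of powers and of beta densities. -/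

section Mellin

/-- The normalizing constant of the Mellin transform. -/
noncomputable def walkConst (n d : ℕ) : ℝ :=
  Real.Gamma (((n : ℝ) * d + 1) / 2) * Real.Gamma ((n : ℝ) * d / 2) /
    (Real.Gamma (((n : ℝ) * d + n) / 2) * Real.Gamma ((d : ℝ) / 2))

/-- The Mellin transform of the law of the squared norm, in terms of the Gamma function. -/
noncomputable def walkMellin (n d : ℕ) (s : ℂ) : ℂ :=
  (walkConst n d : ℂ) *
    (Complex.Gamma (((n : ℂ) * d + n) / 2 + s) * Complex.Gamma ((d : ℂ) / 2 + s)) /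
    (Complex.Gamma (((n : ℂ) * d + 1) / 2 + s) * Complex.Gamma ((n : ℂ) * d / 2 + s))

theorem Complex.Gamma_ofReal_add_natCast {a : ℝ} (ha : 0 < a) (m : ℕ) :
    Complex.Gamma ((a : ℂ) + m) = ((poch a m * Real.Gamma a : ℝ) : ℂ) := by
  rw [Complex.Gamma_add_natCast (by simpa using ha), ← ofReal_poch, Complex.Gamma_ofReal]
  push_cast; rfl

theorem walkConst_pos {n d : ℕ} (hn : 0 < n) (hd : 0 < d) : 0 < walkConst n d := by
  have h1 := Real.Gamma_pos_of_pos (show (0 : ℝ) < ((n : ℝ) * d + 1) / 2 by positivity)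
  have h2 := Real.Gamma_pos_of_pos (show (0 : ℝ) < (n : ℝ) * d / 2 by positivity)
  have h3 := Real.Gamma_pos_of_pos (show (0 : ℝ) < ((n : ℝ) * d + n) / 2 by positivity)
  have h4 := Real.Gamma_pos_of_pos (show (0 : ℝ) < (d : ℝ) / 2 by positivity)
  unfold walkConst
  positivity

/-- Each `Γ(a + m)` is `(a)_m Γ(a)`, and `walkConst` cancels the four values `Γ(a)`. The right side
is the expression for the moments of `V`. -/
theorem walkMellin_natCast {n d : ℕ} (hn : 0 < n) (hd : 0 < d) (m : ℕ) :
    walkMellin n d m = ((poch ((n : ℝ) * (d + 1) / 2) m * poch ((d : ℝ) / 2) m /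
        (poch (((n : ℝ) * d + 1) / 2) m * poch ((n : ℝ) * d / 2) m) : ℝ) : ℂ) := by
  have e1 : (0 : ℝ) < ((n : ℝ) * d + 1) / 2 := by positivity
  have e2 : (0 : ℝ) < (n : ℝ) * d / 2 := by positivity
  have e3 : (0 : ℝ) < ((n : ℝ) * d + n) / 2 := by positivity
  have e4 : (0 : ℝ) < (d : ℝ) / 2 := by positivity
  have g1 := Real.Gamma_pos_of_pos e1
  have g2 := Real.Gamma_pos_of_pos e2
  have g3 := Real.Gamma_pos_of_pos e3
  have g4 := Real.Gamma_pos_of_pos e4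
  have c1 := Complex.Gamma_ofReal_add_natCast e1 m
  have c2 := Complex.Gamma_ofReal_add_natCast e2 m
  have c3 := Complex.Gamma_ofReal_add_natCast e3 m
  have c4 := Complex.Gamma_ofReal_add_natCast e4 m
  have p1 := poch_pos e1 m
  have p2 := poch_pos e2 m
  rw [show (n : ℝ) * (d + 1) / 2 = ((n : ℝ) * d + n) / 2 by ring]
  rw [Complex.ofReal_div] at c1 c2 c3 c4
  simp only [Complex.ofReal_add, Complex.ofReal_mul ((n : ℝ)), Complex.ofReal_natCast,
    Complex.ofReal_one, Complex.ofReal_ofNat] at c1 c2 c3 c4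
  rw [walkMellin, c1, c2, c3, c4, walkConst, ← Complex.ofReal_mul, ← Complex.ofReal_mul,
    ← Complex.ofReal_mul, ← Complex.ofReal_div]
  congr 1
  generalize Real.Gamma (((n : ℝ) * d + 1) / 2) = G1 at *
  generalize Real.Gamma ((n : ℝ) * d / 2) = G2 at *
  generalize Real.Gamma (((n : ℝ) * d + n) / 2) = G3 at *
  generalize Real.Gamma ((d : ℝ) / 2) = G4 at *
  generalize poch (((n : ℝ) * d + 1) / 2) m = q1 at *
  generalize poch ((n : ℝ) * d / 2) m = q2 at *
  generalize poch (((n : ℝ) * d + n) / 2) m = q3 at *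
  field_simp

theorem mellin01_natCast (g : ℝ → ℝ) (m : ℕ) :
    mellin01 g m = ((∫ v in Set.Ioo (0 : ℝ) 1, g v * v ^ m : ℝ) : ℂ) := by
  rw [mellin01, ← integral_complex_ofReal]
  simp

theorem ofReal_rpow_mul_cpow {v : ℝ} (hv : 0 < v) (a : ℝ) (s : ℂ) :
    ((v ^ (a - 1) : ℝ) : ℂ) * (v : ℂ) ^ s = (v : ℂ) ^ ((a : ℂ) + s - 1) := by
  rw [Complex.ofReal_cpow hv.le, ← Complex.cpow_add _ _ (by exact_mod_cast hv.ne')]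
  push_cast; ring_nf

theorem integrableOn_rpow_mul_cpow {a : ℝ} {s : ℂ} (h : 0 < a + s.re) :
    IntegrableOn (fun v : ℝ => ((v ^ (a - 1) : ℝ) : ℂ) * (v : ℂ) ^ s) (Set.Ioo 0 1) := by
  have h1 : IntervalIntegrable (fun v : ℝ => (v : ℂ) ^ ((a : ℂ) + s - 1)) volume 0 1 :=
    intervalIntegral.intervalIntegrable_cpow' (by simp; linarith)
  rw [intervalIntegrable_iff_integrableOn_Ioo_of_le zero_le_one] at h1
  exact h1.congr_fun (fun v hv => (ofReal_rpow_mul_cpow hv.1 a s).symm) measurableSet_Ioo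

theorem mellin01_rpow {a : ℝ} {s : ℂ} (h : 0 < a + s.re) :
    mellin01 (fun v => v ^ (a - 1)) s = 1 / ((a : ℂ) + s) := by
  rw [mellin01, setIntegral_congr_fun measurableSet_Ioo
    (fun v hv => ofReal_rpow_mul_cpow hv.1 a s), ← integral_Ioc_eq_integral_Ioo,
    ← intervalIntegral.integral_of_le zero_le_one, integral_cpow (Or.inl (by simp; linarith))]
  have h0 : (a : ℂ) + s ≠ 0 := fun h0 => by
    have := congrArg Complex.re h0
    simp at this; linarith
  simp [h0]

theorem betaPDFReal_mul_cpow {a b v : ℝ} (hv : v ∈ Set.Ioo (0 : ℝ) 1) (s : ℂ) :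
    (betaPDFReal a b v : ℂ) * (v : ℂ) ^ s =
      (1 / beta a b : ℝ) * ((v : ℂ) ^ ((a : ℂ) + s - 1) * (1 - (v : ℂ)) ^ ((b : ℂ) - 1)) := by
  rw [betaPDFReal, if_pos (Set.mem_Ioo.1 hv), ← ofReal_rpow_mul_cpow hv.1]
  push_cast [Complex.ofReal_cpow (sub_pos.2 hv.2).le]
  ring

theorem integrableOn_betaPDFReal_mul_cpow {a b : ℝ} (hb : 0 < b) {s : ℂ} (h : 0 < a + s.re) :
    IntegrableOn (fun v : ℝ => (betaPDFReal a b v : ℂ) * (v : ℂ) ^ s) (Set.Ioo 0 1) := by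
  have h1 := Complex.betaIntegral_convergent (u := (a : ℂ) + s) (v := b) (by simpa using h)
    (by simpa using hb)
  rw [intervalIntegrable_iff_integrableOn_Ioo_of_le zero_le_one] at h1
  exact IntegrableOn.congr_fun (h1.const_mul ((1 / beta a b : ℝ) : ℂ))
    (fun v hv => (betaPDFReal_mul_cpow hv s).symm) measurableSet_Ioo

theorem mellin01_betaPDFReal {a b : ℝ} (hb : 0 < b) {s : ℂ} (h : 0 < a + s.re) :
    mellin01 (betaPDFReal a b) s =
      (Real.Gamma (a + b) / Real.Gamma a : ℝ) *
        (Complex.Gamma (a + s) / Complex.Gamma ((a + b : ℝ) + s)) := by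
  rw [mellin01, setIntegral_congr_fun measurableSet_Ioo (fun v hv => betaPDFReal_mul_cpow hv s),
    integral_const_mul, ← integral_Ioc_eq_integral_Ioo,
    ← intervalIntegral.integral_of_le zero_le_one]
  have h1 := Complex.betaIntegral_eq_Gamma_mul_div ((a : ℂ) + s) b (by simpa using h)
    (by simpa using hb)
  rw [Complex.betaIntegral] at h1
  rw [h1, beta, Complex.Gamma_ofReal]
  have gb := (Real.Gamma_pos_of_pos hb).ne'
  have gb' : (Real.Gamma b : ℂ) ≠ 0 := by exact_mod_cast gb
  rw [show (a : ℂ) + s + b = (a + b : ℝ) + s by push_cast; ring]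
  push_cast
  field_simp

theorem mellin01_finset_sum {ι : Type*} (t : Finset ι) (c : ι → ℝ) (g : ι → ℝ → ℝ) (s : ℂ)
    (h : ∀ i ∈ t, IntegrableOn (fun v : ℝ => (g i v : ℂ) * (v : ℂ) ^ s) (Set.Ioo 0 1)) :
    IntegrableOn (fun v : ℝ => ((∑ i ∈ t, c i * g i v : ℝ) : ℂ) * (v : ℂ) ^ s) (Set.Ioo 0 1) ∧
      mellin01 (fun v => ∑ i ∈ t, c i * g i v) s = ∑ i ∈ t, (c i : ℂ) * mellin01 (g i) s := by
  have he : (fun v : ℝ => ((∑ i ∈ t, c i * g i v : ℝ) : ℂ) * (v : ℂ) ^ s) =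
      fun v => ∑ i ∈ t, (c i : ℂ) * ((g i v : ℂ) * (v : ℂ) ^ s) := by
    funext v
    push_cast
    rw [Finset.sum_mul]
    simp_rw [mul_assoc]
  constructor
  · rw [he]
    exact integrable_finsetSum _ fun i hi => (h i hi).const_mul _
  · rw [mellin01, he, integral_finsetSum _ fun i hi => (h i hi).const_mul _]
    simp_rw [integral_const_mul, mellin01]

end Mellin

/-! ### Partial fractions with poles at `0, -1, …, -(K - 1)`. -/

section PartialFractions

open Polynomial in
/-- Partial fractions for a quotient of a polynomial by a rising factorial. -/
theorem eval_div_poch_eq_sum {F : Type*} [Field F] [CharZero F] (p : F[X]) (K : ℕ)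
    (hp : p.degree < K) (z : F) (hz : ∀ k < K, z + k ≠ 0) :
    p.eval z / poch z K = ∑ k ∈ Finset.range K,
      p.eval (-(k : F)) / (∏ j ∈ (Finset.range K).erase k, ((j : F) - k)) / (z + k) := by
  have hinj : Set.InjOn (fun k : ℕ => -(k : F)) (Finset.range K) := by
    intro a _ b _ h
    simpa using h
  -- Lagrange interpolation at the nodes `-k` recovers `p`, as its degree is below `K`. The nodal
  -- polynomial at `z` is `poch z K`; dividing by it leaves the simple fractions.
  have h := congrArg (eval z) (Lagrange.eq_interpolate hinj (by simpa using hp))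
  rw [Lagrange.eval_interpolate_not_at_node] at h
  · have hnodal : eval z (Lagrange.nodal (Finset.range K) fun k : ℕ => -(k : F)) = poch z K := by
      simp [Lagrange.eval_nodal, poch]
    have hne : poch z K ≠ 0 :=
      Finset.prod_ne_zero_iff.2 fun k hk => hz k (Finset.mem_range.1 hk)
    rw [hnodal] at h
    rw [h, mul_div_cancel_left₀ _ hne]
    refine Finset.sum_congr rfl fun k _ => ?_
    rw [Lagrange.nodalWeight, Finset.prod_inv_distrib,
      Finset.prod_congr rfl fun (j : ℕ) _ => show (-(k : F) - -(j : F)) = j - k by ring]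
    simp only [sub_neg_eq_add]
    rw [div_eq_mul_inv, div_eq_mul_inv]
    ring
  · intro k hk hzk
    exact hz k (Finset.mem_range.1 hk) (by rw [hzk]; ring)

/-- Exactly the `k` factors with `j < k` are negative. -/
theorem neg_one_pow_mul_prod_erase_pos {K k : ℕ} (hk : k < K) :
    0 < (-1 : ℝ) ^ k * ∏ j ∈ (Finset.range K).erase k, ((j : ℝ) - k) := by
  have hfilter : ((Finset.range K).erase k).filter (· < k) = Finset.range k := by
    ext j; simp; omega
  have h1 : (-1 : ℝ) ^ k = ∏ j ∈ (Finset.range K).erase k, if j < k then (-1 : ℝ) else 1 := by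
    rw [← Finset.prod_filter, hfilter]; simp
  rw [h1, ← Finset.prod_mul_distrib]
  refine Finset.prod_pos fun j hj => ?_
  have hjk := Finset.ne_of_mem_erase hj
  split_ifs with h
  · have : (j : ℝ) < k := by exact_mod_cast h
    linarith
  · have : (k : ℝ) < j := by exact_mod_cast (by omega : k < j)
    linarith

/-- The polynomial `(X + a)_N`. -/
noncomputable def pochPoly {R : Type*} [CommRing R] (a : R) (N : ℕ) : Polynomial R :=
  ∏ i ∈ Finset.range N, (Polynomial.X + Polynomial.C (a + i))

theorem eval_pochPoly {R : Type*} [CommRing R] (a z : R) (N : ℕ) :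
    (pochPoly a N).eval z = poch (z + a) N := by
  simp [pochPoly, poch, Polynomial.eval_prod, add_assoc]

theorem degree_pochPoly {R : Type*} [CommRing R] [IsDomain R] (a : R) (N : ℕ) :
    (pochPoly a N).degree = N := by
  simp only [pochPoly, Polynomial.degree_prod, Polynomial.degree_X_add_C]
  simp

end PartialFractions

/-! ### Identification of the density of `V`. -/

section Density

variable {Ω : Type*} [MeasurableSpace Ω] {P : Measure Ω} [IsProbabilityMeasure P] {n d : ℕ}
  {X : Ω → Fin n → ℝ} {Θ : Fin n → Ω → EuclideanSpace ℝ (Fin d)} {V : Ω → ℝ} {f g : ℝ → ℝ}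

/-- A function with the Mellin transform `walkMellin n d` is a density of the squared norm of the
end point. -/
theorem IsDirichletWalk.hasPDF_and_ae_eq (hn : 0 < n) (hd : 0 < d)
    (hW : IsDirichletWalk P (fun _ => (d : ℝ)) X Θ) (hV : ∀ ω, V ω = ‖walkEnd X Θ ω‖ ^ 2)
    (hf : ∀ v, f v = (pdf V P volume v).toReal) (hg : Measurable g)
    (hint : IntegrableOn g (Set.Ioo 0 1)) (hmom : ∀ m : ℕ, mellin01 g m = walkMellin n d m) :
    HasPDF V P volume ∧ f =ᵐ[volume] (Set.Ioo (0 : ℝ) 1).indicator g := by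
  have hVm : AEMeasurable V P := by
    rw [show V = fun ω => ‖walkEnd X Θ ω‖ ^ 2 from funext hV]
    exact hW.aemeasurable_walkEnd.norm.pow_const 2
  have hsupp : ∀ᵐ x ∂(P.map V), x ∈ Set.Icc (0 : ℝ) 1 := by
    refine (ae_map_iff (p := fun x => x ∈ Set.Icc (0 : ℝ) 1) hVm measurableSet_Icc).2 ?_
    filter_upwards [hW.ae_norm_walkEnd_le] with ω hω
    rw [hV]
    exact ⟨by positivity, pow_le_one₀ (norm_nonneg _) hω⟩
  have hfin : IsProbabilityMeasure (P.map V) := Measure.isProbabilityMeasure_map hVm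
  obtain ⟨h1, h2⟩ := eq_withDensity_of_moments hsupp hg hint fun m => by
    rw [integral_map hVm (by fun_prop)]
    simp_rw [hV]
    rw [hW.integral_norm_sq_pow hn hd]
    have h := hmom m
    rw [mellin01_natCast, walkMellin_natCast hn hd] at h
    exact_mod_cast h.symm
  have hgm : Measurable fun x => ENNReal.ofReal ((Set.Ioo (0 : ℝ) 1).indicator g x) :=
    (hg.indicator measurableSet_Ioo).ennreal_ofReal
  have hpdf : HasPDF V P volume := hasPDF_of_map_eq_withDensity hVm _ hgm.aemeasurable h1
  refine ⟨hpdf, ?_⟩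
  have h3 := (pdf.eq_of_map_eq_withDensity (X := V) _ hgm.aemeasurable).1 h1
  filter_upwards [h2, h3] with x hx hx'
  rw [hf, hx', ENNReal.toReal_ofReal hx]

theorem integrableOn_of_mellin01_zero
    (h : IntegrableOn (fun v : ℝ => (g v : ℂ) * (v : ℂ) ^ (0 : ℂ)) (Set.Ioo 0 1)) :
    IntegrableOn g (Set.Ioo 0 1) := by
  simpa [IntegrableOn] using Integrable.re h

theorem integrableOn_and_mellin01_congr (hfg : f =ᵐ[volume] (Set.Ioo (0 : ℝ) 1).indicator g)
    {s : ℂ} (h : IntegrableOn (fun v : ℝ => (g v : ℂ) * (v : ℂ) ^ s) (Set.Ioo 0 1)) :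
    IntegrableOn (fun v : ℝ => (f v : ℂ) * (v : ℂ) ^ s) (Set.Ioo 0 1) ∧
      mellin01 f s = mellin01 g s := by
  have he : ∀ᵐ v : ℝ, v ∈ Set.Ioo (0 : ℝ) 1 →
      (g v : ℂ) * (v : ℂ) ^ s = (f v : ℂ) * (v : ℂ) ^ s := by
    filter_upwards [hfg] with v hv hv1
    rw [hv, Set.indicator_of_mem hv1]
  refine ⟨IntegrableOn.congr_fun_ae h ((ae_restrict_iff' measurableSet_Ioo).2 he), ?_⟩
  exact (setIntegral_congr_ae measurableSet_Ioo he).symm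

theorem walkMellin_zero (hn : 0 < n) (hd : 0 < d) : walkMellin n d 0 = 1 := by
  simpa using walkMellin_natCast hn hd 0

end Density

/-! ### Odd number of steps: a rational Mellin transform. -/

section Odd

variable {N d : ℕ} {s : ℂ}

/-- The coefficients of the partial fraction expansion of `walkMellin (2 * N + 1) d`. -/
noncomputable def oddCoeff (N d k : ℕ) : ℝ :=
  walkConst (2 * N + 1) d * (poch ((N : ℝ) * d + 1 / 2 - k) N /
    ∏ j ∈ (Finset.range (N * d)).erase k, ((j : ℝ) - k))

/-- At the pole with index `k < N * d` the numerator is a rising factorial starting at `Nd + 1/2 - k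
> 0`, so the sign comes from the product of differences alone. -/
theorem neg_one_pow_mul_oddCoeff_pos (hd : 0 < d) {k : ℕ} (hk : k < N * d) :
    0 < (-1) ^ k * oddCoeff N d k := by
  have h1 := walkConst_pos (n := 2 * N + 1) (by omega) hd
  have h2 := neg_one_pow_mul_prod_erase_pos hk
  have h3 : (0 : ℝ) < (N : ℝ) * d + 1 / 2 - k := by
    have : (k : ℝ) < N * d := by exact_mod_cast hk
    linarith
  have h4 := poch_pos h3 N
  have h5 : ((-1 : ℝ) ^ k) * (-1) ^ k = 1 := by rw [← mul_pow]; simp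
  have h6 : (-1 : ℝ) ^ k * oddCoeff N d k = walkConst (2 * N + 1) d *
      (poch ((N : ℝ) * d + 1 / 2 - k) N /
        ((-1) ^ k * ∏ j ∈ (Finset.range (N * d)).erase k, ((j : ℝ) - k))) := by
    have h7 : ∏ j ∈ (Finset.range (N * d)).erase k, ((j : ℝ) - k) ≠ 0 := by
      intro h; simp [h] at h2
    rw [oddCoeff]
    field_simp
    rw [← pow_mul, mul_comm k 2, pow_mul]
    simp
  rw [h6]
  positivity

/-- For `n = 2N + 1` the Gamma arguments pair up with integer differences `N` and `Nd`, and positive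
real parts allow the cancellation. -/
theorem walkMellin_odd (hs : -((d : ℝ) / 2) < s.re) :
    walkMellin (2 * N + 1) d s = walkConst (2 * N + 1) d *
      poch (s + N * d + ((d : ℂ) + 1) / 2) N / poch ((d : ℂ) / 2 + s) (N * d) := by
  have hNd : (0 : ℝ) ≤ (N : ℝ) * d := by positivity
  have r1 : 0 < (s + N * d + ((d : ℂ) + 1) / 2).re := by
    simp; linarith
  have r2 : 0 < ((d : ℂ) / 2 + s).re := by simp; linarith
  have g1 := Complex.Gamma_ne_zero_of_re_pos r1
  have g2 := Complex.Gamma_ne_zero_of_re_pos r2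
  have e1 := Complex.Gamma_add_natCast r1 N
  have e2 := Complex.Gamma_add_natCast r2 (N * d)
  rw [walkMellin]
  push_cast at e2 ⊢
  rw [show ((2 * (N : ℂ) + 1) * d + (2 * N + 1)) / 2 + s =
      s + N * d + ((d : ℂ) + 1) / 2 + N by ring, e1,
    show ((2 * (N : ℂ) + 1) * d + 1) / 2 + s = s + N * d + ((d : ℂ) + 1) / 2 by ring,
    show (2 * (N : ℂ) + 1) * d / 2 + s = (d : ℂ) / 2 + s + N * d by ring, e2]
  generalize Complex.Gamma (s + N * d + ((d : ℂ) + 1) / 2) = G1 at *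
  generalize Complex.Gamma ((d : ℂ) / 2 + s) = G2 at *
  rw [show (walkConst (2 * N + 1) d : ℂ) * (poch (s + N * d + ((d : ℂ) + 1) / 2) N * G1 * G2) =
    (walkConst (2 * N + 1) d * poch (s + N * d + ((d : ℂ) + 1) / 2) N) * (G1 * G2) by ring,
    show G1 * (poch ((d : ℂ) / 2 + s) (N * d) * G2) =
      poch ((d : ℂ) / 2 + s) (N * d) * (G1 * G2) by ring,
    mul_div_mul_right _ _ (mul_ne_zero g1 g2)]

theorem walkMellin_odd_eq_sum (hN : 0 < N) (hd : 1 < d) (hs : -((d : ℝ) / 2) < s.re) :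
    walkMellin (2 * N + 1) d s =
      ∑ k ∈ Finset.range (N * d), (oddCoeff N d k : ℂ) / ((d : ℂ) / 2 + k + s) := by
  -- `d > 1` makes the numerator degree `N` strictly less than `N * d`, so there is no polynomial
  -- part.
  have hdeg : (pochPoly ((N : ℂ) * d + 1 / 2) N).degree < (N * d : ℕ) := by
    rw [degree_pochPoly]
    exact_mod_cast (by nlinarith : N < N * d)
  have h := eval_div_poch_eq_sum _ (N * d) hdeg ((d : ℂ) / 2 + s) fun k _ h0 => by
    have h1 := congrArg Complex.re h0
    have : (0 : ℝ) ≤ k := by positivity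
    simp at h1; linarith
  simp_rw [eval_pochPoly] at h
  rw [walkMellin_odd hs, mul_div_assoc,
    show s + (N : ℂ) * d + ((d : ℂ) + 1) / 2 = (d : ℂ) / 2 + s + (N * d + 1 / 2) by ring, h,
    Finset.mul_sum]
  refine Finset.sum_congr rfl fun k _ => ?_
  rw [oddCoeff]
  push_cast [ofReal_poch]
  rw [show -(k : ℂ) + (N * d + 1 / 2) = N * d + 1 / 2 - k by ring, mul_div_assoc,
    show (d : ℂ) / 2 + s + k = d / 2 + k + s by ring]

theorem mellin01_oddDensity (hN : 0 < N) (hd : 1 < d) (hs : -((d : ℝ) / 2) < s.re) :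
    IntegrableOn (fun v : ℝ => ((∑ k ∈ Finset.range (N * d),
      oddCoeff N d k * v ^ ((d : ℝ) / 2 + k - 1) : ℝ) : ℂ) * (v : ℂ) ^ s) (Set.Ioo 0 1) ∧
    mellin01 (fun v => ∑ k ∈ Finset.range (N * d), oddCoeff N d k * v ^ ((d : ℝ) / 2 + k - 1)) s =
      walkMellin (2 * N + 1) d s := by
  have hpos : ∀ k : ℕ, 0 < (d : ℝ) / 2 + k + s.re := fun k => by
    have : (0 : ℝ) ≤ k := by positivity
    linarith
  obtain ⟨h1, h2⟩ := mellin01_finset_sum (Finset.range (N * d)) (oddCoeff N d)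
    (fun k v => v ^ ((d : ℝ) / 2 + k - 1)) s fun k _ => integrableOn_rpow_mul_cpow (hpos k)
  refine ⟨h1, h2.trans ?_⟩
  rw [walkMellin_odd_eq_sum hN hd hs]
  refine Finset.sum_congr rfl fun k _ => ?_
  rw [mellin01_rpow (hpos k)]
  push_cast
  rw [mul_one_div]

end Odd

/-! ### Even number of steps: mixtures of beta densities. -/

section Even

variable {N d : ℕ} {s : ℂ}

theorem mixWeight_pos (hN : 0 < N) (hd : 0 < d) {k : ℕ} (hk : k ≤ N) : 0 < mixWeight d N k := by
  have hN1 : (1 : ℝ) ≤ N := by exact_mod_cast hN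
  have hd1 : (0 : ℝ) < d := by exact_mod_cast hd
  have h1 := poch_pos (show (0 : ℝ) < (N : ℝ) * d by positivity) N
  have h2 := poch_pos (show (0 : ℝ) < (d : ℝ) / 2 by positivity) k
  have h3 := poch_pos (show (0 : ℝ) < (d : ℝ) * (N - 1 / 2) from mul_pos hd1 (by linarith)) (N - k)
  have h4 : (0 : ℝ) < N.choose k := by exact_mod_cast Nat.choose_pos hk
  unfold mixWeight
  positivity

/-- The worst case is `k = N`, where the value is `(N - 1/2)(d - 1)`. -/
theorem betaParam_pos (hN : 0 < N) (hd : 1 < d) {k : ℕ} (hk : k ≤ N) :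
    0 < (N : ℝ) * d - ((d : ℝ) - 1) / 2 - k := by
  have hN1 : (1 : ℝ) ≤ N := by exact_mod_cast hN
  have hd1 : (1 : ℝ) < d := by exact_mod_cast hd
  have hk1 : (k : ℝ) ≤ N := by exact_mod_cast hk
  nlinarith [mul_pos (show (0 : ℝ) < N - 1 / 2 by linarith) (sub_pos.2 hd1)]

theorem sum_mixWeight (hN : 0 < N) (hd : 0 < d) :
    ∑ k ∈ Finset.range (N + 1), mixWeight d N k = 1 := by
  have h1 := (poch_pos (show (0 : ℝ) < (N : ℝ) * d by positivity) N).ne'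
  have h := poch_add_eq_sum ((d : ℝ) / 2) ((d : ℝ) * (N - 1 / 2)) N
  rw [Finset.Nat.sum_antidiagonal_eq_sum_range_succ
    (fun i j => (N.choose i : ℝ) * (poch ((d : ℝ) / 2) i * poch ((d : ℝ) * (N - 1 / 2)) j)),
    show (d : ℝ) / 2 + d * (N - 1 / 2) = N * d by ring] at h
  rw [← div_self h1, eq_div_iff h1]
  nth_rw 2 [h]
  rw [Finset.sum_mul]
  refine Finset.sum_congr rfl fun k _ => ?_
  rw [mixWeight]; field_simp

theorem walkConst_even (hN : 0 < N) (hd : 0 < d) :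
    walkConst (2 * N) d = Real.Gamma ((N : ℝ) * d + 1 / 2) / Real.Gamma ((d : ℝ) / 2) /
      poch ((N : ℝ) * d) N := by
  have e : (0 : ℝ) < (N : ℝ) * d := by positivity
  have g := (Real.Gamma_pos_of_pos e).ne'
  have h := Real.Gamma_add_natCast e N
  rw [walkConst]
  push_cast
  rw [show (2 * (N : ℝ) * d + 1) / 2 = N * d + 1 / 2 by ring,
    show 2 * (N : ℝ) * d / 2 = N * d by ring,
    show (2 * (N : ℝ) * d + 2 * N) / 2 = N * d + N by ring, h, div_div,
    show poch ((N : ℝ) * d) N * Real.Gamma (N * d) * Real.Gamma ((d : ℝ) / 2) =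
      Real.Gamma ((d : ℝ) / 2) * poch ((N : ℝ) * d) N * Real.Gamma (N * d) by ring,
    mul_div_mul_right _ _ g]

theorem walkMellin_even (hN : 0 < N) (hs : -((d : ℝ) / 2) < s.re) :
    walkMellin (2 * N) d s = walkConst (2 * N) d *
      (Complex.Gamma ((d : ℂ) / 2 + s) / Complex.Gamma ((N : ℂ) * d + 1 / 2 + s)) *
        poch (s + N * d) N := by
  have hNd : (d : ℝ) / 2 ≤ (N : ℝ) * d := by
    have hN1 : (1 : ℝ) ≤ N := by exact_mod_cast hN
    have hd0 : (0 : ℝ) ≤ d := by positivity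
    nlinarith
  have r1 : 0 < (s + N * d).re := by simp; linarith
  have g1 := Complex.Gamma_ne_zero_of_re_pos r1
  have e1 := Complex.Gamma_add_natCast r1 N
  rw [walkMellin]
  push_cast
  rw [show (2 * (N : ℂ) * d + 2 * N) / 2 + s = s + N * d + N by ring, e1,
    show (2 * (N : ℂ) * d + 1) / 2 + s = N * d + 1 / 2 + s by ring,
    show 2 * (N : ℂ) * d / 2 + s = s + N * d by ring,
    show (walkConst (2 * N) d : ℂ) * (poch (s + N * d) N * Complex.Gamma (s + N * d) *
      Complex.Gamma ((d : ℂ) / 2 + s)) = walkConst (2 * N) d * Complex.Gamma ((d : ℂ) / 2 + s) *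
        poch (s + N * d) N * Complex.Gamma (s + N * d) by ring,
    mul_div_mul_right _ _ g1]
  ring

/-- Chu–Vandermonde expands `(s + Nd)_N` along `s + Nd = (d/2 + s) + d(N - 1/2)`. In the `k`-th term
`(d/2 + s)_k` is absorbed into `Γ(d/2 + s)`, giving `Γ(d/2 + k + s) / Γ(Nd + 1/2 + s)`: up to a
constant, the transform of a beta density with parameters summing to `Nd + 1/2` for every `k`. -/
theorem mellin01_evenDensity (hN : 0 < N) (hd : 1 < d) (hs : -((d : ℝ) / 2) < s.re) :
    IntegrableOn (fun v : ℝ => ((∑ k ∈ Finset.range (N + 1), mixWeight d N k *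
      betaPDFReal ((d : ℝ) / 2 + k) ((N : ℝ) * d - ((d : ℝ) - 1) / 2 - k) v : ℝ) : ℂ) *
        (v : ℂ) ^ s) (Set.Ioo 0 1) ∧
    mellin01 (fun v => ∑ k ∈ Finset.range (N + 1), mixWeight d N k *
      betaPDFReal ((d : ℝ) / 2 + k) ((N : ℝ) * d - ((d : ℝ) - 1) / 2 - k) v) s =
      walkMellin (2 * N) d s := by
  have hpos : ∀ k : ℕ, 0 < (d : ℝ) / 2 + k + s.re := fun k => by
    have : (0 : ℝ) ≤ k := by positivity
    linarith
  have hb : ∀ k ∈ Finset.range (N + 1), 0 < (N : ℝ) * d - ((d : ℝ) - 1) / 2 - k := fun k hk =>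
    betaParam_pos hN hd (by simpa [Nat.lt_succ_iff] using hk)
  obtain ⟨h1, h2⟩ := mellin01_finset_sum (Finset.range (N + 1)) (mixWeight d N)
    (fun k => betaPDFReal ((d : ℝ) / 2 + k) ((N : ℝ) * d - ((d : ℝ) - 1) / 2 - k)) s
    fun k hk => integrableOn_betaPDFReal_mul_cpow (hb k hk) (hpos k)
  refine ⟨h1, h2.trans ?_⟩
  have e2 : (0 : ℝ) < (d : ℝ) / 2 := by positivity
  have r2 : 0 < ((d : ℂ) / 2 + s).re := by simp; linarith
  have hV := poch_add_eq_sum ((d : ℂ) / 2 + s) ((d : ℂ) * (N - 1 / 2)) N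
  rw [Finset.Nat.sum_antidiagonal_eq_sum_range_succ
    (fun i j => (N.choose i : ℂ) * (poch ((d : ℂ) / 2 + s) i * poch ((d : ℂ) * (N - 1 / 2)) j)),
    show (d : ℂ) / 2 + s + d * (N - 1 / 2) = s + N * d by ring] at hV
  rw [walkMellin_even hN hs, hV, walkConst_even hN (by omega), Finset.mul_sum]
  refine Finset.sum_congr rfl fun k hk => ?_
  rw [mellin01_betaPDFReal (hb k hk) (hpos k), mixWeight,
    show (d : ℝ) / 2 + k + (N * d - (d - 1) / 2 - k) = N * d + 1 / 2 by ring,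
    Real.Gamma_add_natCast e2]
  push_cast [ofReal_poch]
  rw [show (d : ℂ) / 2 + k + s = d / 2 + s + k by ring, Complex.Gamma_add_natCast r2]
  have hp : poch ((d : ℂ) / 2) k ≠ 0 := by
    have := (poch_pos e2 k).ne'
    have h := ofReal_poch ((d : ℝ) / 2) k
    push_cast at h
    rw [← h]
    exact_mod_cast this
  generalize Complex.Gamma (N * d + 1 / 2 + s) = G1
  generalize Complex.Gamma ((d : ℂ) / 2 + s) = G2
  generalize (Real.Gamma ((N : ℝ) * d + 1 / 2) : ℂ) = G3
  generalize (Real.Gamma ((d : ℝ) / 2) : ℂ) = G4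
  generalize poch ((d : ℂ) / 2) k = q1 at *
  rw [show G3 / (q1 * G4) = q1⁻¹ * (G3 / G4) by rw [mul_comm q1, ← div_div]; ring]
  rw [show ∀ a b c x y z w : ℂ, a * q1 * b * c * (q1⁻¹ * x * (y * z / w)) =
    (q1 * q1⁻¹) * (a * b * c * (x * (y * z / w))) by intros; ring, mul_inv_cancel₀ hp]
  ring

theorem withDensity_mixture {t : Finset ℕ} {c : ℕ → ℝ} {a b : ℕ → ℝ} (hc : ∀ k ∈ t, 0 < c k)
    (ha : ∀ k ∈ t, 0 < a k) (hb : ∀ k ∈ t, 0 < b k) :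
    volume.withDensity (fun v => ENNReal.ofReal (∑ k ∈ t, c k * betaPDFReal (a k) (b k) v)) =
      ∑ k ∈ t, ENNReal.ofReal (c k) • betaMeasure (a k) (b k) := by
  have hnn : ∀ k ∈ t, ∀ v, 0 ≤ betaPDFReal (a k) (b k) v := fun k hk v => by
    by_cases hv : 0 < v ∧ v < 1
    · exact (betaPDFReal_pos hv.1 hv.2 (ha k hk) (hb k hk)).le
    · simp [betaPDFReal, hv]
  have hm : ∀ k, Measurable (betaPDF (a k) (b k)) := fun k =>
    (measurable_betaPDFReal (a k) (b k)).ennreal_ofReal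
  ext S hS
  rw [withDensity_apply _ hS, Measure.finsetSum_apply]
  simp_rw [Measure.smul_apply, betaMeasure, withDensity_apply _ hS, smul_eq_mul]
  simp_rw [← lintegral_const_mul _ (hm _)]
  rw [← lintegral_finsetSum _ fun k _ => (hm k).const_mul _]
  refine lintegral_congr fun v => ?_
  rw [ENNReal.ofReal_sum_of_nonneg fun k hk => mul_nonneg (hc k hk).le (hnn k hk v)]
  refine Finset.sum_congr rfl fun k hk => ?_
  rw [ENNReal.ofReal_mul (hc k hk).le]; rfl

end Even

/-! ### The Mellin transform of the density and the main theorem. -/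

/-- A function with the Mellin transform `walkMellin n d` on the half-plane `-d / 2 < re s` is a
density of the squared norm, which therefore has the same Mellin transform. -/
theorem IsDirichletWalk.density_mellin {Ω : Type*} [MeasurableSpace Ω] {P : Measure Ω}
    [IsProbabilityMeasure P] {n d : ℕ} {X : Ω → Fin n → ℝ}
    {Θ : Fin n → Ω → EuclideanSpace ℝ (Fin d)} {V : Ω → ℝ} {f g : ℝ → ℝ} (hn : 0 < n) (hd : 0 < d)
    (hW : IsDirichletWalk P (fun _ => (d : ℝ)) X Θ) (hV : ∀ ω, V ω = ‖walkEnd X Θ ω‖ ^ 2)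
    (hf : ∀ v, f v = (pdf V P volume v).toReal) (hg : Measurable g)
    (hmellin : ∀ s : ℂ, -((d : ℝ) / 2) < s.re →
      IntegrableOn (fun v : ℝ => (g v : ℂ) * (v : ℂ) ^ s) (Set.Ioo 0 1) ∧
        mellin01 g s = walkMellin n d s) :
    HasPDF V P volume ∧ f =ᵐ[volume] (Set.Ioo (0 : ℝ) 1).indicator g ∧ mellin01 f 0 = 1 ∧
      ∀ s : ℂ, -((d : ℝ) / 2) < s.re →
        IntegrableOn (fun v : ℝ => (f v : ℂ) * (v : ℂ) ^ s) (Set.Ioo 0 1) ∧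
          mellin01 f s = walkMellin n d s := by
  have hd2 : (0 : ℝ) < (d : ℝ) / 2 := by positivity
  have hre : ∀ m : ℕ, -((d : ℝ) / 2) < (m : ℂ).re := fun m => by
    have : (0 : ℝ) ≤ m := by positivity
    rw [Complex.natCast_re]; linarith
  have hint : IntegrableOn g (Set.Ioo 0 1) :=
    integrableOn_of_mellin01_zero (hmellin 0 (by simpa using hre 0)).1
  -- Only the values at natural numbers enter here. The other `s` follow from `f = g` almost
  -- everywhere on `(0, 1)`, without analytic continuation.
  obtain ⟨h1, h2⟩ := hW.hasPDF_and_ae_eq hn hd hV hf hg hint fun m => (hmellin m (hre m)).2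
  have h3 : ∀ s : ℂ, -((d : ℝ) / 2) < s.re →
      IntegrableOn (fun v : ℝ => (f v : ℂ) * (v : ℂ) ^ s) (Set.Ioo 0 1) ∧
        mellin01 f s = walkMellin n d s := fun s hs => by
    obtain ⟨h4, h5⟩ := hmellin s hs
    obtain ⟨h6, h7⟩ := integrableOn_and_mellin01_congr h2 h4
    exact ⟨h6, h7.trans h5⟩
  exact ⟨h1, h2, (h3 0 (by simpa using hre 0)).2.trans (walkMellin_zero hn hd), h3⟩

theorem theorem11 {Ω : Type*} [MeasurableSpace Ω] (P : Measure Ω) [IsProbabilityMeasure P]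
    (n d : ℕ) (hn : 2 ≤ n) (hd : 1 < d)
    (X : Ω → Fin n → ℝ) (Θ : Fin n → Ω → EuclideanSpace ℝ (Fin d))
    (hW : IsDirichletWalk P (fun _ => (d : ℝ)) X Θ)
    (V : Ω → ℝ) (hV : ∀ ω, V ω = ‖walkEnd X Θ ω‖ ^ 2)
    (f : ℝ → ℝ) (hf : ∀ v, f v = (pdf V P volume v).toReal) :
    -- `V` has a density `f`, and `f` vanishes off `(0, 1)`
    HasPDF V P volume ∧ (∀ᵐ v, v ∉ Set.Ioo (0 : ℝ) 1 → f v = 0) ∧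
    ∃ C : ℝ,
      mellin01 f 0 = 1 ∧
      (∀ s : ℂ, -((d : ℝ) / 2) < s.re →
        IntegrableOn (fun v : ℝ => (f v : ℂ) * (v : ℂ) ^ s) (Set.Ioo 0 1) ∧
        mellin01 f s =
          C * (Complex.Gamma (((n : ℂ) * d + n) / 2 + s) * Complex.Gamma ((d : ℂ) / 2 + s)) /
            (Complex.Gamma (((n : ℂ) * d + 1) / 2 + s) *
              Complex.Gamma ((n : ℂ) * d / 2 + s))) ∧
      (∀ N : ℕ, n = 2 * N + 1 →
        ∃ A : ℕ → ℝ,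
          (∀ s : ℂ, -((d : ℝ) / 2) < s.re →
            mellin01 f s =
              C * poch (s + N * d + ((d : ℂ) + 1) / 2) N / poch ((d : ℂ) / 2 + s) (N * d) ∧
            mellin01 f s =
              ∑ k ∈ Finset.range (N * d), (A k : ℂ) / ((d : ℂ) / 2 + k + s)) ∧
          (∀ᵐ v, v ∈ Set.Ioo (0 : ℝ) 1 →
            f v = ∑ k ∈ Finset.range (N * d), A k * v ^ ((d : ℝ) / 2 + k - 1)) ∧
          ∀ k < N * d, 0 < (-1) ^ k * A k) ∧
      (∀ N : ℕ, n = 2 * N →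
        (∀ s : ℂ, -((d : ℝ) / 2) < s.re →
          mellin01 f s =
            C * (Complex.Gamma ((d : ℂ) / 2 + s) / Complex.Gamma ((N : ℂ) * d + 1 / 2 + s)) *
              poch (s + N * d) N) ∧
        (∀ k ≤ N, 0 < mixWeight d N k ∧ 0 < (N : ℝ) * d - ((d : ℝ) - 1) / 2 - k) ∧
        ∑ k ∈ Finset.range (N + 1), mixWeight d N k = 1 ∧
        volume.withDensity (fun v => ENNReal.ofReal (f v)) =
          ∑ k ∈ Finset.range (N + 1), ENNReal.ofReal (mixWeight d N k) •
            betaMeasure ((d : ℝ) / 2 + k) ((N : ℝ) * d - ((d : ℝ) - 1) / 2 - k)) := by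
  have hd0 : 0 < d := by omega
  rcases Nat.even_or_odd' n with ⟨N, rfl | rfl⟩
  · have hN : 0 < N := by omega
    have hk : ∀ k ∈ Finset.range (N + 1), k ≤ N := fun k hk => by
      simpa [Nat.lt_succ_iff] using hk
    obtain ⟨h1, h2, h3, h4⟩ := hW.density_mellin (by omega) hd0 hV hf
      (g := fun v => ∑ k ∈ Finset.range (N + 1), mixWeight d N k *
        betaPDFReal ((d : ℝ) / 2 + k) ((N : ℝ) * d - ((d : ℝ) - 1) / 2 - k) v)
      (by fun_prop) fun s hs => mellin01_evenDensity hN hd hs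
    refine ⟨h1, ?_, walkConst (2 * N) d, h3, fun s hs => ⟨(h4 s hs).1, (h4 s hs).2⟩,
      fun N' hN' => by omega, fun N' hN' => ?_⟩
    · filter_upwards [h2] with v hv hv'
      rw [hv, Set.indicator_of_notMem hv']
    obtain rfl : N = N' := by omega
    refine ⟨fun s hs => (h4 s hs).2.trans (walkMellin_even hN hs),
      fun k hk => ⟨mixWeight_pos hN hd0 hk, betaParam_pos hN hd hk⟩, sum_mixWeight hN hd0, ?_⟩
    rw [← withDensity_mixture (fun k h => mixWeight_pos hN hd0 (hk k h))
      (a := fun k => (d : ℝ) / 2 + k) (fun k _ => by positivity)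
      (fun k h => betaParam_pos hN hd (hk k h))]
    refine withDensity_congr_ae ?_
    filter_upwards [h2] with v hv
    rw [hv]
    -- The beta densities vanish off `(0, 1)`, so the indicator can be dropped.
    by_cases hv1 : v ∈ Set.Ioo (0 : ℝ) 1
    · rw [Set.indicator_of_mem hv1]
    · rw [Set.indicator_of_notMem hv1]
      congr 1
      refine (Finset.sum_eq_zero fun k _ => ?_).symm
      rw [betaPDFReal, if_neg (fun h => hv1 (Set.mem_Ioo.2 h)), mul_zero]
  · have hN : 0 < N := by omega
    obtain ⟨h1, h2, h3, h4⟩ := hW.density_mellin (by omega) hd0 hV hf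
      (g := fun v => ∑ k ∈ Finset.range (N * d), oddCoeff N d k * v ^ ((d : ℝ) / 2 + k - 1))
      (by fun_prop) fun s hs => mellin01_oddDensity hN hd hs
    refine ⟨h1, ?_, walkConst (2 * N + 1) d, h3, fun s hs => ⟨(h4 s hs).1, (h4 s hs).2⟩,
      fun N' hN' => ?_, fun N' hN' => by omega⟩
    · filter_upwards [h2] with v hv hv'
      rw [hv, Set.indicator_of_notMem hv']
    obtain rfl : N = N' := by omega
    refine ⟨oddCoeff N d, fun s hs => ⟨(h4 s hs).2.trans (walkMellin_odd hs),
      (h4 s hs).2.trans (walkMellin_odd_eq_sum hN hd hs)⟩, ?_,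
      fun k hk => neg_one_pow_mul_oddCoeff_pos hd0 hk⟩
    filter_upwards [h2] with v hv hv'
    rw [hv, Set.indicator_of_mem hv']
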